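/- Let $\hbar>0$, let $\rho,c,\theta\in\mathbb R$, $c'=c+i\theta$ and $K=\begin{pmatrix}\rho& ic'\\ ic'&\rho\end{pmatrix}$, and suppose that $\left|\frac{1+\rho+ic'}{1-\rho-ic'}\right|\neq 1$, that $|\theta|$ is small in the sense that $|\theta|<|\rho|$, and that $c\neq 0$. Put $J=\begin{pmatrix}0&-1\\1&0\end{pmatrix}$, $\Lambda=K+J$, and, with $(u_1,u_2)=(u,v)$, let $$f*_Kg=\sum_{k\ge 0}\frac{(i\hbar)^k}{k!\,2^k}\sum\Lambda_{i_1j_1}\cdots\Lambda_{i_kj_k}\,\partial_{u_{i_1}}\cdots\partial_{u_{i_k}}f\;\partial_{u_{j_1}}\cdots\partial_{u_{j_k}}g ,$$ where one factor is a polynomial in $(u,v)$ and the other a holomorphic function on $\mathbb C^2$; write $a\circ b=\frac12(a*_Kb+b*_Ka)$. For a polynomial $H$ (already written in $K$-ordered form) and a holomorphic $g$, the product $e_*^{H}*g$ is defined if the equation $\frac{d}{dt}F_t=H*_KF_t$, $F_0=g$, has a unique real analytic solution on $0\le t\le1$, through holomorphic functions on $\mathbb C^2$; it is then $F_1$. Similarly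 $g*e_*^{H}$ is defined by $\frac{d}{dt}F_t=F_t*_KH$, $F_0=g$. Put $e_*^H=e_*^H*1$. The polar element and its three square roots are $$\varepsilon_{00}=e_*^{\frac{\pi i}{i\hbar}u\circ v},\quad e_1=e_*^{\frac{\pi i}{2i\hbar}u\circ v},\quad e_2=e_*^{\frac{\pi}{4i\hbar}(u\circ u+v\circ v)},\quad e_3=e_*^{\frac{\pi i}{4i\hbar}(u\circ u-v\circ v)} .$$ Then these four star-exponentials are defined, and they generate an associative unital complex algebra $\mathcal A$ of holomorphic functions on $\mathbb C^2$, with unit the constant $1$, whose product is the $*_K$-product: for every $a\in\mathcal A$, the elements $\varepsilon_{00}*a$, $a*\varepsilon_{00}$, $e_i*a$, $a*e_i$ ($i=1,2$) are defined by the evolution equations above and equal the products in $\mathcal A$; so does $e_3*e_3$; and so do $e_3*a$ and $a*e_3$ for every $a\in\mathcal A$, unless $(|\rho|-|\theta|)^2+c^2\le1\le(|\rho|+|\theta|)^2+c^2$. In $\mathcal A$ one has $\varepsilon_{00}^2=1$, $e_i^2=\varepsilon_{00}$, $e_1*e_2=e_3$, $e_2*e_3=e_1$, $e_3*e_1=e_2$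 and $e_i*e_j=\varepsilon_{00}*e_j*e_i$ for $i\ne j$. The elements $p=\frac12(1+\varepsilon_{00})$ and $q=\frac12(1-\varepsilon_{00})$ are idempotents with $1=p+q$ and $p*q=q*p=0$. Put $\hat e_i=q*e_i$. Then $q*\varepsilon_{00}=-q$, $\hat e_i^2=-q$ and $\hat e_i*\hat e_j=-q*\hat e_j*\hat e_i$ for $i\neq j$, and $q*\mathcal A$ (with unit $q$) is isomorphic, as a complex algebra, to the complexified quaternions $\mathbb C\otimes_{\mathbb R}\mathbb H$, with $1\otimes\mathbf i,\,1\otimes\mathbf j,\,1\otimes\mathbf k$ corresponding to $\hat e_1,\hat e_2,\hat e_3$. On the other hand $p*\mathcal A$ (with unit $p$) is isomorphic, as a complex algebra, to the complex group ring of the Klein four-group, the three non-trivial group elements corresponding to $p*e_1,p*e_2,p*e_3$. In particular $q*\mathcal A$ and $p*\mathcal A$ are not isomorphic as rings. -/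

import Mathlib

open scoped Quaternion TensorProduct

/-- Functions of the two generators `(u, v) = (u 0, u 1)`, as functions on `ℂ²`. -/
abbrev Symb : Type := (Fin 2 → ℂ) → ℂ

/-- Polynomial functions of `(u, v)`. -/
abbrev PolySymb : Type := MvPolynomial (Fin 2) ℂ

/-- The standard skew-symmetric matrix. -/
def skewJ : Matrix (Fin 2) (Fin 2) ℂ := !![0, -1; 1, 0]

/-- Iterated partial derivative `∂_{i₁} ⋯ ∂_{iₖ} f` of a function. -/
noncomputable def partials : List (Fin 2) → Symb → Symb
  | [], f => f
  | i :: l, f => fun u => fderiv ℂ (partials l f) u (Pi.single i 1)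

/-- Iterated partial derivative `∂_{i₁} ⋯ ∂_{iₖ} p` of a polynomial. -/
noncomputable def polyPartials : List (Fin 2) → PolySymb → PolySymb
  | [], p => p
  | i :: l, p => MvPolynomial.pderiv i (polyPartials l p)

/-- The product of two polynomials with bidifferential matrix `Λ`:
`∑ₖ (iħ)ᵏ / (k! 2ᵏ) Λ_{i₁j₁} ⋯ Λ_{iₖjₖ} (∂_{i₁} ⋯ ∂_{iₖ} p) (∂_{j₁} ⋯ ∂_{jₖ} q)`.
The terms with `k` above the degree of `p` vanish. -/
noncomputable def polyStar (ħ : ℝ) (Λ : Matrix (Fin 2) (Fin 2) ℂ) (p q : PolySymb) : PolySymb :=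
  ∑ k ∈ Finset.range (p.totalDegree + 1), ∑ i : Fin k → Fin 2, ∑ j : Fin k → Fin 2,
    MvPolynomial.C ((Complex.I * ħ) ^ k / (k.factorial * 2 ^ k) * ∏ l, Λ (i l) (j l)) *
      (polyPartials (List.ofFn i) p * polyPartials (List.ofFn j) q)

/-- The same product of a polynomial `p` and a function `f`. With `Λ = K + J` this is `p *_K f`;
with the transposed matrix `Λ = (K + J)ᵀ` it is `f *_K p`. -/
noncomputable def starMul (ħ : ℝ) (Λ : Matrix (Fin 2) (Fin 2) ℂ) (p : PolySymb) (f : Symb) :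
    Symb := fun u =>
  ∑ k ∈ Finset.range (p.totalDegree + 1), ∑ i : Fin k → Fin 2, ∑ j : Fin k → Fin 2,
    (Complex.I * ħ) ^ k / (k.factorial * 2 ^ k) * (∏ l, Λ (i l) (j l)) *
      (MvPolynomial.eval u (polyPartials (List.ofFn i) p) * partials (List.ofFn j) f u)

/-- `F` is a real analytic solution over the time interval `[0, 1]`, through holomorphic functions
on `ℂ²`, of the evolution equation `dF/dt = H * F`, `F 0 = g`, where `*` has bidifferential
matrix `Λ`. -/
structure IsStarEvolution (ħ : ℝ) (Λ : Matrix (Fin 2) (Fin 2) ℂ) (H : PolySymb) (g : Symb)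
    (F : ℝ → Symb) : Prop where
  analytic : AnalyticOnNhd ℝ (fun x : ℝ × (Fin 2 → ℂ) => F x.1 x.2)
    (Set.Icc (0 : ℝ) 1 ×ˢ Set.univ)
  holomorphic : ∀ t ∈ Set.Icc (0 : ℝ) 1, Differentiable ℂ (F t)
  evolution : ∀ t ∈ Set.Icc (0 : ℝ) 1, ∀ u,
    HasDerivAt (fun s => F s u) (starMul ħ Λ H (F t) u) t
  initial : F 0 = g

/-- The evolution equation for `H` with initial value `g` has a solution on `[0, 1]`, it is the
only one, and its value at time `1` is `h`. -/
def EvolvesTo (ħ : ℝ) (Λ : Matrix (Fin 2) (Fin 2) ℂ) (H : PolySymb) (g h : Symb) : Prop :=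
  ∃ F : ℝ → Symb, IsStarEvolution ħ Λ H g F ∧ F 1 = h ∧
    ∀ F' : ℝ → Symb, IsStarEvolution ħ Λ H g F' → Set.EqOn F' F (Set.Icc 0 1)

/-- `h` is the `K`-ordered expression of `e_*^H * g`. -/
def IsStarExpMul (ħ : ℝ) (K : Matrix (Fin 2) (Fin 2) ℂ) (H : PolySymb) (g h : Symb) : Prop :=
  EvolvesTo ħ (K + skewJ) H g h

/-- `h` is the `K`-ordered expression of `g * e_*^H`. -/
def IsMulStarExp (ħ : ℝ) (K : Matrix (Fin 2) (Fin 2) ℂ) (H : PolySymb) (g h : Symb) : Prop :=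
  EvolvesTo ħ (K + skewJ).transpose H g h

/-- `h` is the `K`-ordered expression of the star-exponential `e_*^H`. -/
def IsStarExp (ħ : ℝ) (K : Matrix (Fin 2) (Fin 2) ℂ) (H : PolySymb) (h : Symb) : Prop :=
  IsStarExpMul ħ K H (fun _ => 1) h

/-- The `K`-ordered expression of `u_i ∘ u_j = (u_i * u_j + u_j * u_i) / 2`. -/
noncomputable def symProd (ħ : ℝ) (K : Matrix (Fin 2) (Fin 2) ℂ) (i j : Fin 2) : PolySymb :=
  (1 / 2 : ℂ) • (polyStar ħ (K + skewJ) (MvPolynomial.X i) (MvPolynomial.X j) +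
    polyStar ħ (K + skewJ) (MvPolynomial.X j) (MvPolynomial.X i))

/-- The exponent `(πi / iħ) u∘v` of the polar element. -/
noncomputable def polarExponent (ħ : ℝ) (K : Matrix (Fin 2) (Fin 2) ℂ) : PolySymb :=
  (Real.pi * Complex.I / (Complex.I * ħ) : ℂ) • symProd ħ K 0 1

/-- The exponents `(πi / 2iħ) u∘v`, `(π / 4iħ) (u² + v²)`, `(πi / 4iħ) (u² - v²)` of
`e₁`, `e₂`, `e₃`. -/
noncomputable def rootExponent (ħ : ℝ) (K : Matrix (Fin 2) (Fin 2) ℂ) : Fin 3 → PolySymb :=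
  ![(Real.pi * Complex.I / (2 * Complex.I * ħ) : ℂ) • symProd ħ K 0 1,
    (Real.pi / (4 * Complex.I * ħ) : ℂ) • (symProd ħ K 0 0 + symProd ħ K 1 1),
    (Real.pi * Complex.I / (4 * Complex.I * ħ) : ℂ) • (symProd ħ K 0 0 - symProd ħ K 1 1)]

/-- The expression parameter `[[ρ, ic'], [ic', ρ]]`. -/
noncomputable def Kre (ρ : ℝ) (c' : ℂ) : Matrix (Fin 2) (Fin 2) ℂ :=
  !![(ρ : ℂ), Complex.I * c'; Complex.I * c', (ρ : ℂ)]

/-- The subalgebra `p * 𝒜` (closed under products, in general not containing `1`). -/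
def piece {𝒜 : Type} [Ring 𝒜] [Algebra ℂ 𝒜] (p : 𝒜) : NonUnitalSubalgebra ℂ 𝒜 where
  carrier := {x | ∃ a, x = p * a}
  add_mem' := by
    rintro _ _ ⟨a, rfl⟩ ⟨b, rfl⟩
    exact ⟨a + b, (mul_add p a b).symm⟩
  zero_mem' := ⟨0, (mul_zero p).symm⟩
  mul_mem' := by
    rintro _ _ ⟨a, rfl⟩ ⟨b, rfl⟩
    exact ⟨a * (p * b), mul_assoc p a (p * b)⟩
  smul_mem' := by
    rintro z _ ⟨a, rfl⟩
    exact ⟨z • a, (mul_smul_comm z p a).symm⟩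

/-! Divided by `iħ`, quadratic polynomials in `u, v` form a Lie algebra under the star commutator,
and the exponents here span a copy of the imaginary quaternions. Accordingly each unit quaternion
`a` has an explicit Gaussian `starGauss` with amplitude `discr ^ (-1/2)`. Its phase is a quadratic
form whose coefficients are affine functions of `a` divided by `discr`. When `a` moves along `cos s
• b + sin s • n * b` with `n` an imaginary unit, the Gaussian solves the evolution equation of the
Hamiltonian of `n`. This is the polynomial identity `evolution_identity_aux`, and the unit norm of
`a` is what makes it hold. Right multiplication is the same identity with one sign `σ` reversed.

The amplitude is a square root, so in general such Gaussians multiply only up to sign. The sign is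
under control as long as `discr` avoids the negative real axis and 0 along the path, so that the
principal logarithm stays analytic. `discr_mem_slitPlane` proves this for every great circle through
two of the quaternions `1, i, j, k`, except that the circle through `i` and `j` needs the extra
condition in the statement. That circle is met only when `e₃` multiplies `±e₁` or `±e₂`.

Uniqueness of analytic solutions is automatic (`IsStarEvolution.eq_zero`): the equation determines
all time derivatives at 0. An explicit solution therefore computes a star-exponential product, and
by linearity it suffices to treat the eight elements of the quaternion group.

The exponents of `e₁, e₂, e₃` are rotations by the angle `π/2` about `i, j, k`, ending at `i, j, k`,
and the polar exponent is a rotation by `π`, ending at `-1`. The eight Gaussians are linearly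
independent (`linearIndependent_starGauss`), so their span is a copy of the complex group ring of
the quaternion group. That ring splits as `StarAlg`: complexified quaternions, where `-1` acts as
`-1`, times the group ring of the Klein four-group, where it acts as `1`. The algebraic relations
are then read off in `StarAlg`. One factor is commutative and the other is not. -/

/-! ### Uniqueness of analytic solutions, and linearity in the initial value. -/

section Uniqueness

open Filter Topology Set

/-- The derivative in the direction `v`. -/
noncomputable def dirDeriv {E : Type*} [NormedAddCommGroup E] [NormedSpace ℝ E] (v : E)
    (G : E → ℂ) : E → ℂ := fun x => fderiv ℝ G x v

theorem AnalyticAt.dirDeriv {E : Type*} [NormedAddCommGroup E] [NormedSpace ℝ E] {G : E → ℂ}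
    {x : E} (h : AnalyticAt ℝ G x) (v : E) : AnalyticAt ℝ (dirDeriv v G) x :=
  (ContinuousLinearMap.apply ℝ ℂ v).analyticAt _ |>.comp h.fderiv

theorem fderiv_dirDeriv {E : Type*} [NormedAddCommGroup E] [NormedSpace ℝ E] {G : E → ℂ}
    {x : E} (h : AnalyticAt ℝ G x) (v w : E) :
    fderiv ℝ (dirDeriv v G) x w = fderiv ℝ (fderiv ℝ G) x w v := by
  have h1 : HasFDerivAt (dirDeriv v G)
      ((ContinuousLinearMap.apply ℝ ℂ v).comp (fderiv ℝ (fderiv ℝ G) x)) x :=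
    (ContinuousLinearMap.apply ℝ ℂ v).hasFDerivAt.comp x h.fderiv.differentiableAt.hasFDerivAt
  rw [h1.fderiv]; rfl

theorem dirDeriv_comm {E : Type*} [NormedAddCommGroup E] [NormedSpace ℝ E] {G : E → ℂ}
    {x : E} (h : AnalyticAt ℝ G x) (v w : E) :
    dirDeriv w (dirDeriv v G) x = dirDeriv v (dirDeriv w G) x := by
  change fderiv ℝ (dirDeriv v G) x w = fderiv ℝ (dirDeriv w G) x v
  rw [fderiv_dirDeriv h, fderiv_dirDeriv h]
  exact (h.contDiffAt (n := 2)).isSymmSndFDerivAt (by simp) w v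

/-- Holomorphic functions on `ℂ²` which are also real analytic. -/
structure IsEntire (f : Symb) : Prop where
  differentiable : Differentiable ℂ f
  analytic : ∀ u, AnalyticAt ℝ f u

theorem IsEntire.fderiv_apply {f : Symb} (hf : IsEntire f) (v : Fin 2 → ℂ) :
    (fun u => fderiv ℂ f u v) = _root_.dirDeriv v f := by
  funext u
  simp [_root_.dirDeriv, (hf.differentiable u).fderiv_restrictScalars ℝ]

/-- A directional derivative of a real analytic function is real analytic, so only complex linearity
of its real derivative is at stake; it follows from the symmetry of second derivatives. -/
theorem IsEntire.partial {f : Symb} (hf : IsEntire f) (v : Fin 2 → ℂ) :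
    IsEntire (fun u => fderiv ℂ f u v) := by
  rw [hf.fderiv_apply]
  refine ⟨fun u => ?_, fun u => (hf.analytic u).dirDeriv v⟩
  have hd := (((hf.analytic u).dirDeriv v).differentiableAt)
  rw [differentiableAt_iff_restrictScalars ℝ hd]
  -- Exchange the order of the two derivatives, use that `f` is holomorphic in the inner one, and
  -- exchange back.
  have hI : ∀ w, fderiv ℝ (_root_.dirDeriv v f) u (Complex.I • w) =
      Complex.I • fderiv ℝ (_root_.dirDeriv v f) u w := by
    intro w
    have e1 := dirDeriv_comm (hf.analytic u) v w
    have e2 := dirDeriv_comm (hf.analytic u) v (Complex.I • w)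
    have e3 : _root_.dirDeriv (Complex.I • w) f = fun x => Complex.I • _root_.dirDeriv w f x := by
      rw [← hf.fderiv_apply, ← hf.fderiv_apply]; funext x; simp
    change _root_.dirDeriv _ _ u = _ • _root_.dirDeriv _ _ u
    rw [e1, e2, e3]
    simp only [_root_.dirDeriv]
    have := ((hf.analytic u).dirDeriv w).differentiableAt.hasFDerivAt.const_smul Complex.I
    rw [show (fun x => Complex.I • fderiv ℝ f x w) = Complex.I • _root_.dirDeriv w f from rfl,
      this.fderiv]
    rfl
  refine ⟨⟨⟨⟨fderiv ℝ (_root_.dirDeriv v f) u, map_add _⟩, fun z w => ?_⟩,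
    (fderiv ℝ (_root_.dirDeriv v f) u).continuous⟩, rfl⟩
  have : z • w = z.re • w + z.im • (Complex.I • w) := by
    conv_lhs => rw [← Complex.re_add_im z, add_smul, mul_smul]
    rfl
  simp only [RingHom.id_apply]
  rw [this, map_add, map_smul, map_smul, hI]
  conv_rhs => rw [← Complex.re_add_im z]
  simp only [smul_eq_mul, Complex.real_smul]
  ring

theorem IsEntire.partials {f : Symb} (hf : IsEntire f) : ∀ l, IsEntire (partials l f)
  | [] => hf
  | _ :: l => (hf.partials l).partial _

theorem IsEntire.add {f g : Symb} (hf : IsEntire f) (hg : IsEntire g) : IsEntire (f + g) :=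
  ⟨hf.1.add hg.1, fun u => (hf.2 u).add (hg.2 u)⟩

theorem IsEntire.smul {f : Symb} (hf : IsEntire f) (z : ℂ) : IsEntire (z • f) :=
  ⟨hf.1.const_smul z, fun u => analyticAt_const.mul (hf.2 u)⟩

theorem partials_add {f g : Symb} (hf : IsEntire f) (hg : IsEntire g) :
    ∀ l, partials l (f + g) = partials l f + partials l g
  | [] => rfl
  | i :: l => by
    funext u
    simp only [partials, partials_add hf hg l, Pi.add_apply]
    rw [fderiv_add ((hf.partials l).1 u) ((hg.partials l).1 u)]; rfl

theorem partials_smul {f : Symb} (hf : IsEntire f) (z : ℂ) :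
    ∀ l, partials l (z • f) = z • partials l f
  | [] => rfl
  | i :: l => by
    funext u
    simp only [partials, partials_smul hf z l, Pi.smul_apply]
    rw [fderiv_const_smul ((hf.partials l).1 u)]; rfl

theorem starMul_add (ħ : ℝ) (Λ : Matrix (Fin 2) (Fin 2) ℂ) (H : PolySymb) {f g : Symb}
    (hf : IsEntire f) (hg : IsEntire g) :
    starMul ħ Λ H (f + g) = starMul ħ Λ H f + starMul ħ Λ H g := by
  funext u
  simp only [starMul, partials_add hf hg, Pi.add_apply, mul_add, Finset.sum_add_distrib]

theorem starMul_smul (ħ : ℝ) (Λ : Matrix (Fin 2) (Fin 2) ℂ) (H : PolySymb) {f : Symb}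
    (hf : IsEntire f) (z : ℂ) : starMul ħ Λ H (z • f) = z • starMul ħ Λ H f := by
  funext u
  simp only [starMul, partials_smul hf, Pi.smul_apply, smul_eq_mul, Finset.mul_sum]
  refine Finset.sum_congr rfl fun k _ => Finset.sum_congr rfl fun i _ =>
    Finset.sum_congr rfl fun j _ => by ring

variable {ħ : ℝ} {Λ : Matrix (Fin 2) (Fin 2) ℂ} {H : PolySymb}

theorem IsStarEvolution.isEntire {g : Symb} {F : ℝ → Symb} (h : IsStarEvolution ħ Λ H g F)
    {t : ℝ} (ht : t ∈ Icc (0 : ℝ) 1) : IsEntire (F t) :=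
  ⟨h.holomorphic t ht, fun u => (h.analytic (t, u) ⟨ht, trivial⟩).comp
    (f := fun u : Fin 2 → ℂ => (t, u)) (analyticAt_const.prod analyticAt_id)⟩

theorem IsStarEvolution.add {g g' : Symb} {F F' : ℝ → Symb} (h : IsStarEvolution ħ Λ H g F)
    (h' : IsStarEvolution ħ Λ H g' F') : IsStarEvolution ħ Λ H (g + g') (F + F') where
  analytic x hx := (h.analytic x hx).add (h'.analytic x hx)
  holomorphic t ht := (h.holomorphic t ht).add (h'.holomorphic t ht)
  evolution t ht u := by
    rw [Pi.add_apply, starMul_add ħ Λ H (h.isEntire ht) (h'.isEntire ht)]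
    exact (h.evolution t ht u).add (h'.evolution t ht u)
  initial := by rw [Pi.add_apply, h.initial, h'.initial]

theorem IsStarEvolution.smul {g : Symb} {F : ℝ → Symb} (h : IsStarEvolution ħ Λ H g F) (z : ℂ) :
    IsStarEvolution ħ Λ H (z • g) (z • F) where
  analytic x hx := analyticAt_const.mul (h.analytic x hx)
  holomorphic t ht := (h.holomorphic t ht).const_smul z
  evolution t ht u := by
    rw [Pi.smul_apply, starMul_smul ħ Λ H (h.isEntire ht)]
    exact (h.evolution t ht u).const_smul z
  initial := by rw [Pi.smul_apply, h.initial]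

/-- Iterated derivatives in the directions of the space coordinates. -/
noncomputable def spaceDeriv : List (Fin 2) → (ℝ × (Fin 2 → ℂ) → ℂ) → ℝ × (Fin 2 → ℂ) → ℂ
  | [], G => G
  | i :: l, G => dirDeriv (0, Pi.single i 1) (spaceDeriv l G)

theorem AnalyticAt.spaceDeriv {G : ℝ × (Fin 2 → ℂ) → ℂ} {x : ℝ × (Fin 2 → ℂ)}
    (h : AnalyticAt ℝ G x) : ∀ l, AnalyticAt ℝ (spaceDeriv l G) x
  | [] => h
  | _ :: l => (h.spaceDeriv l).dirDeriv _

theorem dirDeriv_congr {E : Type*} [NormedAddCommGroup E] [NormedSpace ℝ E] {G G' : E → ℂ}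
    {x : E} (h : G =ᶠ[𝓝 x] G') (v : E) : dirDeriv v G x = dirDeriv v G' x := by
  simp only [dirDeriv, h.fderiv_eq]

theorem dirDeriv_spaceDeriv {G : ℝ × (Fin 2 → ℂ) → ℂ} (v : ℝ × (Fin 2 → ℂ)) :
    ∀ (l : List (Fin 2)) {x : ℝ × (Fin 2 → ℂ)}, AnalyticAt ℝ G x →
      dirDeriv v (spaceDeriv l G) x = spaceDeriv l (dirDeriv v G) x
  | [], _, _ => rfl
  | i :: l, x, h => by
    change dirDeriv v (dirDeriv _ (spaceDeriv l G)) x = dirDeriv _ (spaceDeriv l (dirDeriv v G)) x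
    rw [dirDeriv_comm (h.spaceDeriv l)]
    refine dirDeriv_congr ?_ _
    filter_upwards [h.eventually_analyticAt] with y hy using dirDeriv_spaceDeriv v l hy

theorem hasFDerivAt_slice {G : ℝ × (Fin 2 → ℂ) → ℂ} {t : ℝ} {u : Fin 2 → ℂ}
    (h : AnalyticAt ℝ G (t, u)) : HasFDerivAt (fun w => G (t, w))
      ((fderiv ℝ G (t, u)).comp (ContinuousLinearMap.inr ℝ ℝ (Fin 2 → ℂ))) u :=
  h.differentiableAt.hasFDerivAt.comp u (hasFDerivAt_prodMk_right t u)

theorem hasDerivAt_slice {G : ℝ × (Fin 2 → ℂ) → ℂ} {t : ℝ} {u : Fin 2 → ℂ}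
    (h : AnalyticAt ℝ G (t, u)) :
    HasDerivAt (fun s => G (s, u)) (dirDeriv (1, 0) G (t, u)) t := by
  have := (h.differentiableAt.hasFDerivAt.comp t (hasFDerivAt_prodMk_left t u)).hasDerivAt
  simpa [dirDeriv, Function.comp_def] using this

theorem spaceDeriv_eq_zero {G : ℝ × (Fin 2 → ℂ) → ℂ} {t : ℝ} (h : ∀ u, AnalyticAt ℝ G (t, u))
    (h0 : ∀ u, G (t, u) = 0) : ∀ l u, spaceDeriv l G (t, u) = 0
  | [], u => h0 u
  | i :: l, u => by
    have h1 := (hasFDerivAt_slice ((h u).spaceDeriv l)).fderiv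
    have h2 : (fun w => spaceDeriv l G (t, w)) = fun _ => 0 :=
      funext fun w => spaceDeriv_eq_zero h h0 l w
    rw [h2] at h1
    simpa [spaceDeriv, dirDeriv] using (DFunLike.congr_fun h1 (Pi.single i 1)).symm

/-- Replaces complex derivatives of the time slices by real derivatives of one function of time and
space, which commute with the time derivative. -/
theorem IsStarEvolution.partials_eq {g : Symb} {F : ℝ → Symb} (h : IsStarEvolution ħ Λ H g F)
    {t : ℝ} (ht : t ∈ Icc (0 : ℝ) 1) : ∀ (l : List (Fin 2)) (u : Fin 2 → ℂ),
      partials l (F t) u = spaceDeriv l (fun x => F x.1 x.2) (t, u)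
  | [], u => rfl
  | i :: l, u => by
    have ha := h.analytic (t, u) ⟨ht, trivial⟩
    have e : partials l (F t) = fun w => spaceDeriv l (fun x => F x.1 x.2) (t, w) :=
      funext (h.partials_eq ht l)
    change (fun w => fderiv ℂ (partials l (F t)) w (Pi.single i 1)) u = _
    rw [((h.isEntire ht).partials l).fderiv_apply, e, dirDeriv,
      (hasFDerivAt_slice (ha.spaceDeriv l)).fderiv]
    rfl

/-- The operator `starMul` in terms of derivatives of functions of time and space. -/
noncomputable def spaceStar (ħ : ℝ) (Λ : Matrix (Fin 2) (Fin 2) ℂ) (p : PolySymb)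
    (G : ℝ × (Fin 2 → ℂ) → ℂ) : ℝ × (Fin 2 → ℂ) → ℂ := fun x =>
  ∑ k ∈ Finset.range (p.totalDegree + 1), ∑ i : Fin k → Fin 2, ∑ j : Fin k → Fin 2,
    (Complex.I * ħ) ^ k / (k.factorial * 2 ^ k) * (∏ l, Λ (i l) (j l)) *
      (MvPolynomial.eval x.2 (polyPartials (List.ofFn i) p) * spaceDeriv (List.ofFn j) G x)

theorem hasDerivAt_spaceStar {G : ℝ × (Fin 2 → ℂ) → ℂ} {t : ℝ} {u : Fin 2 → ℂ}
    (h : AnalyticAt ℝ G (t, u)) :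
    HasDerivAt (fun s => spaceStar ħ Λ H G (s, u))
      (spaceStar ħ Λ H (dirDeriv (1, 0) G) (t, u)) t := by
  unfold spaceStar
  refine HasDerivAt.fun_sum fun k _ => HasDerivAt.fun_sum fun i _ => HasDerivAt.fun_sum fun j _ => ?_
  have := hasDerivAt_slice (h.spaceDeriv (List.ofFn j))
  rw [dirDeriv_spaceDeriv _ _ h] at this
  exact (this.const_mul (MvPolynomial.eval u (polyPartials (List.ofFn i) H))).const_mul _

/-- Differentiating the equation in time gives `T (k + 1) = H * T k` on `[0, 1]`, since `H` does not
depend on time. Zero initial data then make every time derivative vanish at 0, and the identity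
theorem spreads this over the interval. -/
theorem IsStarEvolution.eq_zero {F : ℝ → Symb} (h : IsStarEvolution ħ Λ H 0 F) :
    ∀ t ∈ Icc (0 : ℝ) 1, F t = 0 := by
  set G : ℝ × (Fin 2 → ℂ) → ℂ := fun x => F x.1 x.2 with hG
  set T : ℕ → ℝ × (Fin 2 → ℂ) → ℂ := fun k => (dirDeriv (1, 0))^[k] G with hT
  have hTs : ∀ k, T (k + 1) = dirDeriv (1, 0) (T k) := fun k =>
    Function.iterate_succ_apply' _ _ _
  have hTa : ∀ k x, AnalyticAt ℝ G x → AnalyticAt ℝ (T k) x := by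
    intro k x hx
    induction k with
    | zero => exact hx
    | succ k ih => rw [hTs]; exact ih.dirDeriv _
  have hS : ∀ t ∈ Icc (0 : ℝ) 1, ∀ u, AnalyticAt ℝ G (t, u) := fun t ht u =>
    h.analytic (t, u) ⟨ht, trivial⟩
  have key : ∀ k, ∀ t ∈ Icc (0 : ℝ) 1, ∀ u, T (k + 1) (t, u) = spaceStar ħ Λ H (T k) (t, u) := by
    intro k
    induction k with
    | zero =>
      intro t ht u
      have h1 := h.evolution t ht u
      have h2 := hasDerivAt_slice (hS t ht u)
      rw [hTs]
      change dirDeriv (1, 0) G (t, u) = _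
      rw [h2.unique h1]
      simp only [starMul, spaceStar, h.partials_eq ht]
      rfl
    | succ k ih =>
      intro t ht u
      -- The equation is known only for times in `[0, 1]`, so the two derivatives are compared
      -- within the interval, which also covers its endpoints.
      have h1 := (hasDerivAt_slice (hTa (k + 1) _ (hS t ht u))).hasDerivWithinAt (s := Icc (0 : ℝ) 1)
      have h2 := (hasDerivAt_spaceStar (ħ := ħ) (Λ := Λ) (H := H)
        (hTa k _ (hS t ht u))).hasDerivWithinAt (s := Icc (0 : ℝ) 1)
      have h3 := h2.congr (fun s hs => ih s hs u) (ih t ht u)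
      rw [hTs (k + 1), (uniqueDiffOn_Icc zero_lt_one t ht).eq_deriv _ h1 h3, ← hTs]
  have h01 : (0 : ℝ) ∈ Icc (0 : ℝ) 1 := by simp
  have hT0 : ∀ k u, T k (0, u) = 0 := by
    intro k
    induction k with
    | zero => intro u; exact congrFun h.initial u
    | succ k ih =>
      intro u
      rw [key k 0 h01 u]
      simp [spaceStar, spaceDeriv_eq_zero (fun u => hTa k _ (hS 0 h01 u)) ih]
  intro t ht
  funext u
  have hsl : ∀ s, AnalyticAt ℝ G (s, u) → AnalyticAt ℝ (fun s => G (s, u)) s := fun s hs =>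
    hs.comp (f := fun s : ℝ => (s, u)) (analyticAt_id.prod analyticAt_const)
  have hit : ∀ k s, AnalyticAt ℝ G (s, u) → iteratedDeriv k (fun s => G (s, u)) s = T k (s, u) := by
    intro k
    induction k with
    | zero => intro s _; simp [hT]
    | succ k ih =>
      intro s hs
      have hc : ContinuousAt (fun r : ℝ => (r, u)) s := by fun_prop
      -- The induction runs over all points of analyticity, an open set, because differentiating
      -- once more needs equality on a neighbourhood.
      have : iteratedDeriv k (fun s => G (s, u)) =ᶠ[𝓝 s] fun s => T k (s, u) := by
        filter_upwards [hc.eventually hs.eventually_analyticAt] with r hr using ih r hr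
      rw [iteratedDeriv_succ, this.deriv_eq, (hasDerivAt_slice (hTa k _ hs)).deriv, hTs]
  have hz : (fun s => G (s, u)) =ᶠ[𝓝 0] 0 := by
    have htop : analyticOrderAt (fun s => G (s, u)) 0 = ⊤ := by
      refine ENat.eq_top_iff_forall_ge.2 fun n => ?_
      rw [natCast_le_analyticOrderAt_iff_iteratedDeriv_eq_zero (hsl 0 (hS 0 h01 u))]
      intro i _
      rw [hit i 0 (hS 0 h01 u), hT0]
    exact analyticOrderAt_eq_top.1 htop
  have := AnalyticOnNhd.eqOn_zero_of_preconnected_of_eventuallyEq_zero (U := Icc (0 : ℝ) 1)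
    (fun s hs => hsl s (hS s hs u)) isPreconnected_Icc h01 hz
  exact this ht

theorem IsStarEvolution.unique {g : Symb} {F F' : ℝ → Symb} (h : IsStarEvolution ħ Λ H g F)
    (h' : IsStarEvolution ħ Λ H g F') : EqOn F' F (Icc 0 1) := by
  intro t ht
  have h0 : IsStarEvolution ħ Λ H 0 (F' + (-1 : ℂ) • F) := by
    have := h'.add (h.smul (-1))
    simpa using this
  have := h0.eq_zero t ht
  simpa [add_neg_eq_zero] using this

/-- Since uniqueness is automatic, exhibiting one solution is enough. -/
theorem IsStarEvolution.evolvesTo {g : Symb} {F : ℝ → Symb} (h : IsStarEvolution ħ Λ H g F) :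
    EvolvesTo ħ Λ H g (F 1) :=
  ⟨F, h, rfl, fun _ h' => h.unique h'⟩

theorem EvolvesTo.add {g g' f f' : Symb} (h : EvolvesTo ħ Λ H g f) (h' : EvolvesTo ħ Λ H g' f') :
    EvolvesTo ħ Λ H (g + g') (f + f') := by
  obtain ⟨F, hF, rfl, -⟩ := h
  obtain ⟨F', hF', rfl, -⟩ := h'
  exact (hF.add hF').evolvesTo

theorem EvolvesTo.smul {g f : Symb} (h : EvolvesTo ħ Λ H g f) (z : ℂ) :
    EvolvesTo ħ Λ H (z • g) (z • f) := by
  obtain ⟨F, hF, rfl, -⟩ := h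
  exact (hF.smul z).evolvesTo

end Uniqueness

/-! ### The star product with a quadratic polynomial, and derivatives of Gaussians. -/

section StarFormula

open MvPolynomial

theorem totalDegree_pderiv_le {d : ℕ} {p : PolySymb} (h : p.totalDegree ≤ d + 1) (i : Fin 2) :
    (pderiv i p).totalDegree ≤ d := by
  rw [p.as_sum, map_sum]
  refine totalDegree_finsetSum_le fun s hs => ?_
  rw [pderiv_monomial]
  by_cases h0 : s i = 0
  · simp [h0]
  refine (totalDegree_monomial_le _ _).trans ?_
  have h1 : s.degree ≤ d + 1 := (le_totalDegree hs).trans h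
  have h2 : (s - Finsupp.single i 1) + Finsupp.single i 1 = s :=
    tsub_add_cancel_of_le (by simpa [Nat.one_le_iff_ne_zero] using h0)
  have h3 := congrArg Finsupp.degree h2
  rw [map_add, Finsupp.degree_single] at h3
  change (s - Finsupp.single i 1).degree ≤ d
  omega

theorem pderiv_eq_zero_of_totalDegree {p : PolySymb} (h : p.totalDegree = 0) (i : Fin 2) :
    pderiv i p = 0 := by
  rw [totalDegree_eq_zero_iff_eq_C.1 h, pderiv_C]

theorem polyPartials_totalDegree {d : ℕ} {p : PolySymb} (h : p.totalDegree ≤ d) :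
    ∀ l : List (Fin 2), (polyPartials l p).totalDegree ≤ d - l.length
  | [] => by simpa [polyPartials] using h
  | i :: l => by
    have := polyPartials_totalDegree h l
    rcases Nat.eq_zero_or_pos (d - l.length) with h0 | h0
    · rw [polyPartials, pderiv_eq_zero_of_totalDegree (by omega)]; simp
    · refine (totalDegree_pderiv_le (d := d - l.length - 1) (by omega) i).trans ?_
      simp; omega

theorem polyPartials_eq_zero {d : ℕ} {p : PolySymb} (h : p.totalDegree ≤ d) :
    ∀ l : List (Fin 2), d < l.length → polyPartials l p = 0
  | [], hl => by simp at hl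
  | i :: l, hl => by
    have := polyPartials_totalDegree h l
    rw [List.length_cons] at hl
    exact pderiv_eq_zero_of_totalDegree (by omega) i

/-- Derivatives beyond the degree vanish, so any degree bound may be used to truncate. This gives
one formula for all quadratic polynomials, whichever coefficients happen to be zero. -/
theorem starMul_eq_sum_range (ħ : ℝ) (Λ : Matrix (Fin 2) (Fin 2) ℂ) {d : ℕ} {p : PolySymb}
    (h : p.totalDegree ≤ d) (f : Symb) (u : Fin 2 → ℂ) : starMul ħ Λ p f u =
    ∑ k ∈ Finset.range (d + 1), ∑ i : Fin k → Fin 2, ∑ j : Fin k → Fin 2,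
      (Complex.I * ħ) ^ k / (k.factorial * 2 ^ k) * (∏ l, Λ (i l) (j l)) *
        (eval u (polyPartials (List.ofFn i) p) * partials (List.ofFn j) f u) := by
  refine Finset.sum_subset (Finset.range_subset_range.2 (by omega)) fun k _ hk => ?_
  refine Finset.sum_eq_zero fun i _ => Finset.sum_eq_zero fun j _ => ?_
  rw [polyPartials_eq_zero le_rfl _ (by simp at hk ⊢; omega)]
  simp

/-- The polynomial `α u² + β u v + γ v² + κ`. -/
noncomputable def quadPoly (α β γ κ : ℂ) : PolySymb :=
  C α * X 0 ^ 2 + C β * (X 0 * X 1) + C γ * X 1 ^ 2 + C κ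

theorem quadPoly_totalDegree (α β γ κ : ℂ) : (quadPoly α β γ κ).totalDegree ≤ 2 := by
  have hX : ∀ (z : ℂ) (i j : Fin 2), (C z * (X i * X j) : PolySymb).totalDegree ≤ 2 := by
    intro z i j
    refine (totalDegree_mul _ _).trans ?_
    rw [totalDegree_C, zero_add]
    exact (totalDegree_mul _ _).trans (by simp)
  unfold quadPoly
  rw [pow_two, pow_two]
  refine (totalDegree_add _ _).trans (max_le ((totalDegree_add _ _).trans
    (max_le ((totalDegree_add _ _).trans (max_le (hX _ _ _) (hX _ _ _))) (hX _ _ _))) ?_)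
  simp

theorem sum_fin_one_fun {M : Type*} [AddCommMonoid M] (g : (Fin 1 → Fin 2) → M) :
    ∑ i, g i = g ![0] + g ![1] := by
  rw [← Equiv.sum_comp (Equiv.funUnique (Fin 1) (Fin 2)).symm, Fin.sum_univ_two]
  congr 2 <;> (funext x; fin_cases x; rfl)

theorem sum_fin_two_fun {M : Type*} [AddCommMonoid M] (g : (Fin 2 → Fin 2) → M) :
    ∑ i, g i = g ![0, 0] + g ![0, 1] + (g ![1, 0] + g ![1, 1]) := by
  rw [← Equiv.sum_comp (finTwoArrowEquiv (Fin 2)).symm, Fintype.sum_prod_type]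
  simp only [Fin.sum_univ_two, finTwoArrowEquiv_symm_apply]

theorem starMul_quadPoly (ħ : ℝ) (Λ : Matrix (Fin 2) (Fin 2) ℂ) (α β γ κ : ℂ) (f : Symb)
    (u : Fin 2 → ℂ) : starMul ħ Λ (quadPoly α β γ κ) f u =
    (α * u 0 ^ 2 + β * (u 0 * u 1) + γ * u 1 ^ 2 + κ) * f u +
    Complex.I * ħ / 2 * ((2 * α * u 0 + β * u 1) * (Λ 0 0 * partials [0] f u +
        Λ 0 1 * partials [1] f u) + (β * u 0 + 2 * γ * u 1) * (Λ 1 0 * partials [0] f u +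
        Λ 1 1 * partials [1] f u)) +
    (Complex.I * ħ) ^ 2 / 8 * (
      2 * α * (Λ 0 0 * Λ 0 0 * partials [0, 0] f u + Λ 0 0 * Λ 0 1 * partials [0, 1] f u +
        Λ 0 1 * Λ 0 0 * partials [1, 0] f u + Λ 0 1 * Λ 0 1 * partials [1, 1] f u) +
      β * (Λ 0 0 * Λ 1 0 * partials [0, 0] f u + Λ 0 0 * Λ 1 1 * partials [0, 1] f u +
        Λ 0 1 * Λ 1 0 * partials [1, 0] f u + Λ 0 1 * Λ 1 1 * partials [1, 1] f u) +
      β * (Λ 1 0 * Λ 0 0 * partials [0, 0] f u + Λ 1 0 * Λ 0 1 * partials [0, 1] f u +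
        Λ 1 1 * Λ 0 0 * partials [1, 0] f u + Λ 1 1 * Λ 0 1 * partials [1, 1] f u) +
      2 * γ * (Λ 1 0 * Λ 1 0 * partials [0, 0] f u + Λ 1 0 * Λ 1 1 * partials [0, 1] f u +
        Λ 1 1 * Λ 1 0 * partials [1, 0] f u + Λ 1 1 * Λ 1 1 * partials [1, 1] f u)) := by
  rw [starMul_eq_sum_range ħ Λ (quadPoly_totalDegree α β γ κ), Finset.sum_range_succ,
    Finset.sum_range_succ, Finset.sum_range_one]
  simp only [sum_fin_one_fun, sum_fin_two_fun, Finset.univ_unique, Finset.sum_singleton,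
    List.ofFn_succ, List.ofFn_zero, Fin.prod_univ_two, Fin.prod_univ_zero]
  have h0 : polyPartials [0] (quadPoly α β γ κ) = C (2 * α) * X 0 + C β * X 1 := by
    simp [polyPartials, quadPoly, pderiv_X, show (C 2 : PolySymb) = 2 from rfl]; ring
  have h1 : polyPartials [1] (quadPoly α β γ κ) = C β * X 0 + C (2 * γ) * X 1 := by
    simp [polyPartials, quadPoly, pderiv_X, show (C 2 : PolySymb) = 2 from rfl]; ring
  have h00 : polyPartials [0, 0] (quadPoly α β γ κ) = C (2 * α) := by
    rw [polyPartials, h0]; simp [pderiv_X]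
  have h10 : polyPartials [1, 0] (quadPoly α β γ κ) = C β := by
    rw [polyPartials, h0]; simp [pderiv_X]
  have h01 : polyPartials [0, 1] (quadPoly α β γ κ) = C β := by
    rw [polyPartials, h1]; simp [pderiv_X]
  have h11 : polyPartials [1, 1] (quadPoly α β γ κ) = C (2 * γ) := by
    rw [polyPartials, h1]; simp [pderiv_X]
  simp [h0, h1, h00, h01, h10, h11]
  simp [polyPartials, quadPoly, partials]
  ring

/-- The function `exp (l + A u² + B u v + C v²)`. -/
noncomputable def gauss (l A B C : ℂ) : Symb := fun u =>
  Complex.exp (l + A * u 0 ^ 2 + B * (u 0 * u 1) + C * u 1 ^ 2)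

theorem hasFDerivAt_coord (i : Fin 2) (u : Fin 2 → ℂ) :
    HasFDerivAt (fun u : Fin 2 → ℂ => u i) (ContinuousLinearMap.proj (R := ℂ) i) u :=
  (ContinuousLinearMap.proj (R := ℂ) (φ := fun _ : Fin 2 => ℂ) i).hasFDerivAt

theorem partials_gauss (l A B C : ℂ) :
    partials [0] (gauss l A B C) = (fun u => (2 * A * u 0 + B * u 1) * gauss l A B C u) ∧
    partials [1] (gauss l A B C) = (fun u => (B * u 0 + 2 * C * u 1) * gauss l A B C u) := by
  have h := fun u : Fin 2 → ℂ => ((((((hasFDerivAt_coord 0 u).pow 2).const_mul A).const_add l).add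
    (((hasFDerivAt_coord 0 u).mul (hasFDerivAt_coord 1 u)).const_mul B)).add
    (((hasFDerivAt_coord 1 u).pow 2).const_mul C)).cexp
  constructor
  · funext u
    change fderiv ℂ (gauss l A B C) u _ = _
    unfold gauss
    refine (DFunLike.congr_fun (h u).fderiv _).trans ?_
    simp
    ring
  · funext u
    change fderiv ℂ (gauss l A B C) u _ = _
    unfold gauss
    refine (DFunLike.congr_fun (h u).fderiv _).trans ?_
    simp
    ring

theorem differentiable_gauss (l A B C : ℂ) : Differentiable ℂ (gauss l A B C) := by
  unfold gauss
  fun_prop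

theorem fderiv_linear_mul_gauss (l A B C a b : ℂ) (u v : Fin 2 → ℂ) :
    fderiv ℂ (fun u => (a * u 0 + b * u 1) * gauss l A B C u) u v =
      (a * v 0 + b * v 1) * gauss l A B C u + (a * u 0 + b * u 1) * fderiv ℂ (gauss l A B C) u v := by
  have h := (((hasFDerivAt_coord 0 u).const_mul a).add ((hasFDerivAt_coord 1 u).const_mul b)).mul
    (differentiable_gauss l A B C u).hasFDerivAt
  refine (DFunLike.congr_fun h.fderiv _).trans ?_
  simp
  ring

theorem partials_partials_gauss (l A B C : ℂ) (u : Fin 2 → ℂ) :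
    partials [0, 0] (gauss l A B C) u =
      (2 * A + (2 * A * u 0 + B * u 1) ^ 2) * gauss l A B C u ∧
    partials [0, 1] (gauss l A B C) u =
      (B + (2 * A * u 0 + B * u 1) * (B * u 0 + 2 * C * u 1)) * gauss l A B C u ∧
    partials [1, 0] (gauss l A B C) u =
      (B + (2 * A * u 0 + B * u 1) * (B * u 0 + 2 * C * u 1)) * gauss l A B C u ∧
    partials [1, 1] (gauss l A B C) u =
      (2 * C + (B * u 0 + 2 * C * u 1) ^ 2) * gauss l A B C u := by
  have h0 : fderiv ℂ (gauss l A B C) u (Pi.single 0 1) = _ := congrFun (partials_gauss l A B C).1 u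
  have h1 : fderiv ℂ (gauss l A B C) u (Pi.single 1 1) = _ := congrFun (partials_gauss l A B C).2 u
  refine ⟨?_, ?_, ?_, ?_⟩ <;> unfold partials
  · rw [(partials_gauss l A B C).1, fderiv_linear_mul_gauss, h0]; simp; ring
  · rw [(partials_gauss l A B C).2, fderiv_linear_mul_gauss, h0]; simp; ring
  · rw [(partials_gauss l A B C).1, fderiv_linear_mul_gauss, h1]; simp; ring
  · rw [(partials_gauss l A B C).2, fderiv_linear_mul_gauss, h1]; simp; ring

theorem polyStar_X_X (ħ : ℝ) (Λ : Matrix (Fin 2) (Fin 2) ℂ) (i j : Fin 2) :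
    polyStar ħ Λ (X i) (X j) = X i * X j + C (Complex.I * ħ / 2 * Λ i j) := by
  rw [polyStar, totalDegree_X, Finset.sum_range_succ, Finset.sum_range_one]
  simp only [sum_fin_one_fun, Finset.univ_unique, Finset.sum_singleton,
    List.ofFn_succ, List.ofFn_zero, Fin.prod_univ_zero]
  fin_cases i <;> fin_cases j <;> simp [polyPartials, pderiv_X]

end StarFormula

/-! ### The algebraic identities behind the evolution of a Gaussian. -/

section Gaussians

/-- The evolution equation with denominators cleared and `iħ` scaled away: the first identity is the
part quadratic in `x, y`, the second the constant part. The imaginary unit is absorbed in `k`, `b1`,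
`b3`, `m1`, `m3`, which explains the signs in the norm condition `h`. Here `p` and `q` are half the
gradient of the phase numerator. -/
theorem evolution_identity_aux {σ ρ k a0 b1 a2 b3 m1 n2 m3 x y D D' A B C A' B' C' α γ p q : ℂ}
    (hσ : σ = 1 ∨ σ = -1) (h : a0 ^ 2 - b1 ^ 2 + a2 ^ 2 - b3 ^ 2 = 1)
    (hD : D = (1 + (ρ ^ 2 - k ^ 2)) / 2 + (1 - (ρ ^ 2 - k ^ 2)) / 2 * a0 - k * b1 - ρ * a2)
    (hD' : D' = (1 - (ρ ^ 2 - k ^ 2)) / 2 * (m1 * b1 - n2 * a2 + m3 * b3) -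
      k * (a0 * m1 + σ * (n2 * b3 - m3 * a2)) - ρ * (a0 * n2 - σ * (m3 * b1 - m1 * b3)))
    (hA : A = -(1 - a0) * ρ + a2 + b3) (hC : C = -(1 - a0) * ρ + a2 - b3)
    (hB : B = 2 * (k * (1 - a0) + b1))
    (hA' : A' = (m1 * b1 - n2 * a2 + m3 * b3) * ρ + (a0 * n2 - σ * (m3 * b1 - m1 * b3)) +
      (a0 * m3 + σ * (m1 * a2 - n2 * b1)))
    (hC' : C' = (m1 * b1 - n2 * a2 + m3 * b3) * ρ + (a0 * n2 - σ * (m3 * b1 - m1 * b3)) -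
      (a0 * m3 + σ * (m1 * a2 - n2 * b1)))
    (hB' : B' = 2 * (-k * (m1 * b1 - n2 * a2 + m3 * b3) + (a0 * m1 + σ * (n2 * b3 - m3 * a2))))
    (hα : α = (n2 + m3) / 2) (hγ : γ = (n2 - m3) / 2)
    (hp : p = A * x + B * y / 2) (hq : q = B * x / 2 + C * y) :
    (α * x ^ 2 + m1 * (x * y) + γ * y ^ 2) * D ^ 2 + 1 / 2 * ((2 * α * x + m1 * y) *
        (ρ * p + (k - σ) * q) + (m1 * x + 2 * γ * y) * ((k + σ) * p + ρ * q)) * D +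
      1 / 4 * (α * (ρ * p + (k - σ) * q) ^ 2 + m1 * (ρ * p + (k - σ) * q) * ((k + σ) * p + ρ * q) +
        γ * ((k + σ) * p + ρ * q) ^ 2) =
    1 / 2 * ((A' * x ^ 2 + B' * (x * y) + C' * y ^ 2) * D -
      (A * x ^ 2 + B * (x * y) + C * y ^ 2) * D') ∧
    (m1 * k + n2 * ρ) / 2 * D + 1 / 4 * (α * (ρ * ρ * A + 2 * ρ * (k - σ) * (B / 2) + (k - σ) ^ 2 * C) +
      m1 * (ρ * (k + σ) * A + (ρ * ρ + (k - σ) * (k + σ)) * (B / 2) + (k - σ) * ρ * C) +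
      γ * ((k + σ) ^ 2 * A + 2 * (k + σ) * ρ * (B / 2) + ρ * ρ * C)) = -1 / 2 * D' := by
  subst hD hD' hA hB hC hA' hB' hC' hα hγ hp hq
  constructor
  -- The two sides differ by a multiple of norm minus one; only the quadratic part needs the norm
  -- condition.
  · rcases hσ with rfl | rfl
    · linear_combination (-(1/4)*((n2+m3)/2*(ρ*x-(k-1)*y)^2+m1*(ρ*x-(k-1)*y)*((k+1)*x-ρ*y)+(n2-m3)/2*((k+1)*x-ρ*y)^2)+1/2*(x^2-y^2)*((k*n2+ρ*m1)-(1-(ρ^2-k^2))/2*m3))*h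
    · linear_combination (-(1/4)*((n2+m3)/2*(ρ*x-(k+1)*y)^2+m1*(ρ*x-(k+1)*y)*((k-1)*x-ρ*y)+(n2-m3)/2*((k-1)*x-ρ*y)^2)+1/2*(x^2-y^2)*(-(k*n2+ρ*m1)-(1-(ρ^2-k^2))/2*m3))*h
  · rcases hσ with rfl | rfl <;> ring

/-- Dividing the two polynomial identities by `D ^ 2` and `D` and restoring `j = iħ` gives the
equation itself: on the left `H * G` over `G` for a Gaussian `G`, on the right its logarithmic
derivative. -/
theorem evolution_identity {j x y D D' A B C A' B' C' α β γ κ ρ Λ₁ Λ₂ p q : ℂ}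
    (hj : j ≠ 0) (hD : D ≠ 0) (hp : p = A * x + B * y / 2) (hq : q = B * x / 2 + C * y)
    (h₁ : (α * x ^ 2 + β * (x * y) + γ * y ^ 2) * D ^ 2 + 1 / 2 * ((2 * α * x + β * y) *
        (ρ * p + Λ₁ * q) + (β * x + 2 * γ * y) * (Λ₂ * p + ρ * q)) * D +
      1 / 4 * (α * (ρ * p + Λ₁ * q) ^ 2 + β * (ρ * p + Λ₁ * q) * (Λ₂ * p + ρ * q) +
        γ * (Λ₂ * p + ρ * q) ^ 2) =
      1 / 2 * ((A' * x ^ 2 + B' * (x * y) + C' * y ^ 2) * D -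
        (A * x ^ 2 + B * (x * y) + C * y ^ 2) * D'))
    (h₂ : κ * D + 1 / 4 * (α * (ρ * ρ * A + 2 * ρ * Λ₁ * (B / 2) + Λ₁ ^ 2 * C) +
      β * (ρ * Λ₂ * A + (ρ * ρ + Λ₁ * Λ₂) * (B / 2) + Λ₁ * ρ * C) +
      γ * (Λ₂ ^ 2 * A + 2 * Λ₂ * ρ * (B / 2) + ρ * ρ * C)) = -1 / 2 * D') :
    let a := A / (2 * j * D); let b := B / (2 * j * D); let c := C / (2 * j * D)
    let f₀ := 2 * a * x + b * y; let f₁ := b * x + 2 * c * y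
    let f₀₀ := 2 * a + f₀ ^ 2; let f₀₁ := b + f₀ * f₁; let f₁₁ := 2 * c + f₁ ^ 2
    α / j * x ^ 2 + β / j * (x * y) + γ / j * y ^ 2 + κ +
      j / 2 * ((2 * (α / j) * x + β / j * y) * (ρ * f₀ + Λ₁ * f₁) +
        (β / j * x + 2 * (γ / j) * y) * (Λ₂ * f₀ + ρ * f₁)) +
      j ^ 2 / 8 * (
        2 * (α / j) * (ρ * ρ * f₀₀ + ρ * Λ₁ * f₀₁ + Λ₁ * ρ * f₀₁ + Λ₁ * Λ₁ * f₁₁) +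
        β / j * (ρ * Λ₂ * f₀₀ + ρ * ρ * f₀₁ + Λ₁ * Λ₂ * f₀₁ + Λ₁ * ρ * f₁₁) +
        β / j * (Λ₂ * ρ * f₀₀ + Λ₂ * Λ₁ * f₀₁ + ρ * ρ * f₀₁ + ρ * Λ₁ * f₁₁) +
        2 * (γ / j) * (Λ₂ * Λ₂ * f₀₀ + Λ₂ * ρ * f₀₁ + ρ * Λ₂ * f₀₁ + ρ * ρ * f₁₁)) =
      -(1 / 2) * (D' / D) + (A' * (2 * j * D) - A * (2 * j * D')) / (2 * j * D) ^ 2 * x ^ 2 +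
        (B' * (2 * j * D) - B * (2 * j * D')) / (2 * j * D) ^ 2 * (x * y) +
        (C' * (2 * j * D) - C * (2 * j * D')) / (2 * j * D) ^ 2 * y ^ 2 := by
  intro a b c f₀ f₁ f₀₀ f₀₁ f₁₁
  -- Naming the inverses makes both sides polynomial, with `j * z = 1` and `D * w = 1` as the only
  -- relations.
  obtain ⟨z, hz⟩ : ∃ z, z = j⁻¹ := ⟨_, rfl⟩
  obtain ⟨w, hw⟩ : ∃ w, w = D⁻¹ := ⟨_, rfl⟩
  have hjz : j * z = 1 := by rw [hz, mul_inv_cancel₀ hj]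
  have hDw : D * w = 1 := by rw [hw, mul_inv_cancel₀ hD]
  have ha : ∀ X, X / (2 * j * D) = X * z * w / 2 := by intro X; rw [hz, hw]; field_simp
  have ha' : ∀ X X', (X' * (2 * j * D) - X * (2 * j * D')) / (2 * j * D) ^ 2 =
    z * (X' * D - X * D') * w ^ 2 / 2 := by intro X X'; rw [hz, hw]; field_simp
  have hf₀ : f₀ = p * z * w := by simp only [f₀, a, b, ha, hp]; ring
  have hf₁ : f₁ = q * z * w := by simp only [f₁, c, b, ha, hq]; ring
  have key : ∀ P Q R S U : ℂ, (U + Q * w + R * w ^ 2 = S * w ^ 2) ↔ (U * D ^ 2 + Q * D + R = S) := by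
    intro P Q R S U
    rw [hw]; field_simp
  have h₁' : (α * x ^ 2 + β * (x * y) + γ * y ^ 2) + 1 / 2 * ((2 * α * x + β * y) *
        (ρ * p + Λ₁ * q) + (β * x + 2 * γ * y) * (Λ₂ * p + ρ * q)) * w +
      1 / 4 * (α * (ρ * p + Λ₁ * q) ^ 2 + β * (ρ * p + Λ₁ * q) * (Λ₂ * p + ρ * q) +
        γ * (Λ₂ * p + ρ * q) ^ 2) * w ^ 2 =
      1 / 2 * ((A' * x ^ 2 + B' * (x * y) + C' * y ^ 2) * D -
        (A * x ^ 2 + B * (x * y) + C * y ^ 2) * D') * w ^ 2 := by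
    rw [key 0]; exact h₁
  have h₂' : κ + 1 / 4 * (α * (ρ * ρ * A + 2 * ρ * Λ₁ * (B / 2) + Λ₁ ^ 2 * C) +
      β * (ρ * Λ₂ * A + (ρ * ρ + Λ₁ * Λ₂) * (B / 2) + Λ₁ * ρ * C) +
      γ * (Λ₂ ^ 2 * A + 2 * Λ₂ * ρ * (B / 2) + ρ * ρ * C)) * w = -1 / 2 * D' * w := by
    linear_combination w * h₂ - κ * hDw
  have hjz2 : ∀ X Y : ℂ, j ^ 2 * (X * z * (Y * z)) = X * Y := by
    intro X Y; linear_combination X * Y * (j * z + 1) * hjz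
  simp only [f₀₀, f₀₁, f₁₁, hf₀, hf₁, a, b, c, ha, ha', div_eq_mul_inv _ j, ← hz, div_eq_mul_inv D', ← hw]
  obtain ⟨W, hW⟩ : ∃ W, W = 1 / 2 * ((2 * α * x + β * y) * (ρ * p + Λ₁ * q) +
    (β * x + 2 * γ * y) * (Λ₂ * p + ρ * q)) * w := ⟨_, rfl⟩
  obtain ⟨V, hV⟩ : ∃ V, V = 1 / 4 * (α * (ρ * p + Λ₁ * q) ^ 2 +
    β * (ρ * p + Λ₁ * q) * (Λ₂ * p + ρ * q) + γ * (Λ₂ * p + ρ * q) ^ 2) * w ^ 2 := ⟨_, rfl⟩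
  obtain ⟨M, hM⟩ : ∃ M, M = 1 / 4 * (α * (ρ * ρ * A + 2 * ρ * Λ₁ * (B / 2) + Λ₁ ^ 2 * C) +
      β * (ρ * Λ₂ * A + (ρ * ρ + Λ₁ * Λ₂) * (B / 2) + Λ₁ * ρ * C) +
      γ * (Λ₂ ^ 2 * A + 2 * Λ₂ * ρ * (B / 2) + ρ * ρ * C)) * w := ⟨_, rfl⟩
  have e : α * z * x ^ 2 + β * z * (x * y) + γ * z * y ^ 2 + κ + j * z * (W * z) +
      (j * z) ^ 2 * (V * z + M) = -(1 / 2) * (D' * w) + z * (1 / 2 * ((A' * x ^ 2 + B' * (x * y) +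
      C' * y ^ 2) * D - (A * x ^ 2 + B * (x * y) + C * y ^ 2) * D') * w ^ 2) := by
    rw [hjz, ← h₁', ← hW, ← hV]
    rw [← hM] at h₂'
    linear_combination h₂'
  rw [hW, hV, hM] at e
  linear_combination e

end Gaussians

/-! ### Gaussians of unit quaternions solve the evolution equation. -/

section StarGauss

open Set

/-- The value at a quaternion of the discriminant: `discr ^ (-1/2)` is the amplitude of the
`K`-ordered expression of the group element with this quaternion. -/
noncomputable def discr (ρ c' : ℂ) (a : ℍ[ℝ]) : ℂ :=
  (1 + (ρ ^ 2 + c' ^ 2)) / 2 + (1 - (ρ ^ 2 + c' ^ 2)) / 2 * a.re + c' * a.imI - ρ * a.imJ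

/-- Coefficient of `u²` in the numerator of the phase. -/
noncomputable def phaseA (ρ : ℂ) (a : ℍ[ℝ]) : ℂ := -(1 - a.re) * ρ + a.imJ + Complex.I * a.imK

/-- Coefficient of `u v` in the numerator of the phase. -/
noncomputable def phaseB (c' : ℂ) (a : ℍ[ℝ]) : ℂ := 2 * Complex.I * (c' * (1 - a.re) + a.imI)

/-- Coefficient of `v²` in the numerator of the phase. -/
noncomputable def phaseC (ρ : ℂ) (a : ℍ[ℝ]) : ℂ := -(1 - a.re) * ρ + a.imJ - Complex.I * a.imK

/-- The `K`-ordered expression of the group element with quaternion `a`. -/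
noncomputable def starGauss (ħ : ℝ) (ρ c' : ℂ) (a : ℍ[ℝ]) : Symb :=
  gauss (-(1 / 2) * Complex.log (discr ρ c' a)) (phaseA ρ a / (2 * (Complex.I * ħ) * discr ρ c' a))
    (phaseB c' a / (2 * (Complex.I * ħ) * discr ρ c' a))
    (phaseC ρ a / (2 * (Complex.I * ħ) * discr ρ c' a))

/-- The quadratic polynomial generating the one-parameter group of the imaginary quaternion `n`. -/
noncomputable def hamiltonian (ħ : ℝ) (ρ c' : ℂ) (n : ℍ[ℝ]) : PolySymb :=
  quadPoly ((n.imJ + Complex.I * n.imK) / 2 / (Complex.I * ħ)) (Complex.I * n.imI / (Complex.I * ħ))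
    ((n.imJ - Complex.I * n.imK) / 2 / (Complex.I * ħ)) ((-c' * n.imI + ρ * n.imJ) / 2)

/-- For imaginary `n`, this is `n * a` if `σ = 1`, and `a * n` if `σ = -1`. -/
def signedMul (σ : ℝ) (n a : ℍ[ℝ]) : ℍ[ℝ] :=
  ⟨-(n.imI * a.imI + n.imJ * a.imJ + n.imK * a.imK),
    a.re * n.imI + σ * (n.imJ * a.imK - n.imK * a.imJ),
    a.re * n.imJ + σ * (n.imK * a.imI - n.imI * a.imK),
    a.re * n.imK + σ * (n.imI * a.imJ - n.imJ * a.imI)⟩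

/-- The matrix `K + J` for `σ = 1`, and its transpose for `σ = -1`. -/
def signedMatrix (ρ c' : ℂ) (σ : ℝ) : Matrix (Fin 2) (Fin 2) ℂ :=
  !![ρ, Complex.I * c' - σ; Complex.I * c' + σ, ρ]

/-- The right-hand side is written exactly as the chain rule produces it in `hasDerivAt_starGauss`
when `a` moves with velocity `a'`. -/
theorem starMul_hamiltonian {ħ : ℝ} (hħ : ħ ≠ 0) {ρ c' : ℂ} {σ : ℝ} (hσ : σ = 1 ∨ σ = -1)
    {n a a' : ℍ[ℝ]} (ha : a.re ^ 2 + a.imI ^ 2 + a.imJ ^ 2 + a.imK ^ 2 = 1)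
    (ha' : a' = signedMul σ n a) (hD : discr ρ c' a ≠ 0) (u : Fin 2 → ℂ) {D' : ℂ}
    (hD' : D' = (1 - (ρ ^ 2 + c' ^ 2)) / 2 * a'.re + c' * a'.imI - ρ * a'.imJ) :
    starMul ħ (signedMatrix ρ c' σ) (hamiltonian ħ ρ c' n) (starGauss ħ ρ c' a) u =
      starGauss ħ ρ c' a u * (-(1 / 2) * (D' / discr ρ c' a) +
        ((a'.re * ρ + a'.imJ + Complex.I * a'.imK) * (2 * (Complex.I * ħ) * discr ρ c' a) -
          phaseA ρ a * (2 * (Complex.I * ħ) * D')) / (2 * (Complex.I * ħ) * discr ρ c' a) ^ 2 *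
            u 0 ^ 2 +
        (2 * Complex.I * (-c' * a'.re + a'.imI) * (2 * (Complex.I * ħ) * discr ρ c' a) -
          phaseB c' a * (2 * (Complex.I * ħ) * D')) / (2 * (Complex.I * ħ) * discr ρ c' a) ^ 2 *
            (u 0 * u 1) +
        ((a'.re * ρ + a'.imJ - Complex.I * a'.imK) * (2 * (Complex.I * ħ) * discr ρ c' a) -
          phaseC ρ a * (2 * (Complex.I * ħ) * D')) / (2 * (Complex.I * ħ) * discr ρ c' a) ^ 2 *
            u 1 ^ 2) := by
  have hI : Complex.I ^ 2 = -1 := Complex.I_sq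
  have hs : (σ : ℂ) = 1 ∨ (σ : ℂ) = -1 := by rcases hσ with rfl | rfl <;> simp
  have ha1 : (a.re : ℂ) ^ 2 + a.imI ^ 2 + a.imJ ^ 2 + a.imK ^ 2 = 1 := by exact_mod_cast ha
  have hj : Complex.I * (ħ : ℂ) ≠ 0 := by simpa using hħ
  obtain ⟨h₁, h₂⟩ := evolution_identity_aux (σ := σ) (ρ := ρ) (k := Complex.I * c') (a0 := a.re)
    (b1 := Complex.I * a.imI) (a2 := a.imJ) (b3 := Complex.I * a.imK) (m1 := Complex.I * n.imI)
    (n2 := n.imJ) (m3 := Complex.I * n.imK) (x := u 0) (y := u 1)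
    (D := discr ρ c' a) (D' := D') (A := phaseA ρ a) (B := phaseB c' a) (C := phaseC ρ a)
    (A' := a'.re * ρ + a'.imJ + Complex.I * a'.imK) (B' := 2 * Complex.I * (-c' * a'.re + a'.imI))
    (C' := a'.re * ρ + a'.imJ - Complex.I * a'.imK) (α := (n.imJ + Complex.I * n.imK) / 2)
    (γ := (n.imJ - Complex.I * n.imK) / 2) hs
    (by linear_combination ha1 + (-(a.imI : ℂ) ^ 2 - a.imK ^ 2) * hI)
    (by rw [discr]; linear_combination (c' ^ 2 / 2 - c' ^ 2 / 2 * a.re + c' * a.imI) * hI)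
    (by
      rw [hD', ha']; simp only [signedMul]; push_cast
      ring_nf; simp only [hI, Complex.I_pow_four]; ring_nf)
    rfl rfl (by rw [phaseB]; ring)
    (by rw [ha']; simp only [signedMul]; push_cast; ring_nf; simp only [hI]; ring_nf)
    (by rw [ha']; simp only [signedMul]; push_cast; ring_nf; simp only [hI]; ring_nf)
    (by rw [ha']; simp only [signedMul]; push_cast; ring_nf; simp only [Complex.I_pow_three]; ring_nf)
    rfl rfl rfl rfl
  rw [show (Complex.I * n.imI * (Complex.I * c') + n.imJ * ρ) / 2 =
    ((-c' * n.imI + ρ * n.imJ) / 2 : ℂ) by linear_combination (n.imI * c' / 2 : ℂ) * hI] at h₂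
  have := evolution_identity hj hD rfl rfl h₁ h₂
  rw [hamiltonian, starMul_quadPoly, starGauss, ← this, (partials_gauss _ _ _ _).1,
    (partials_gauss _ _ _ _).2]
  obtain ⟨g1, g2, g3, g4⟩ := partials_partials_gauss
    (-(1 / 2) * Complex.log (discr ρ c' a)) (phaseA ρ a / (2 * (Complex.I * ħ) * discr ρ c' a))
    (phaseB c' a / (2 * (Complex.I * ħ) * discr ρ c' a))
    (phaseC ρ a / (2 * (Complex.I * ħ) * discr ρ c' a)) u
  rw [g1, g2, g3, g4]
  simp only [signedMatrix, Matrix.of_apply, Matrix.cons_val', Matrix.cons_val_zero,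
    Matrix.cons_val_one, Matrix.cons_val_fin_one]
  ring

theorem hasDerivAt_starGauss {ħ : ℝ} (hħ : ħ ≠ 0) {ρ c' : ℂ} {a : ℝ → ℍ[ℝ]} {a' : ℍ[ℝ]} {t : ℝ}
    (h0 : HasDerivAt (fun s => (a s).re) a'.re t) (h1 : HasDerivAt (fun s => (a s).imI) a'.imI t)
    (h2 : HasDerivAt (fun s => (a s).imJ) a'.imJ t) (h3 : HasDerivAt (fun s => (a s).imK) a'.imK t)
    (hD : discr ρ c' (a t) ∈ Complex.slitPlane) (u : Fin 2 → ℂ) {D' : ℂ}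
    (hD' : D' = (1 - (ρ ^ 2 + c' ^ 2)) / 2 * a'.re + c' * a'.imI - ρ * a'.imJ) :
    HasDerivAt (fun s => starGauss ħ ρ c' (a s) u) (starGauss ħ ρ c' (a t) u *
      (-(1 / 2) * (D' / discr ρ c' (a t)) +
        ((a'.re * ρ + a'.imJ + Complex.I * a'.imK) * (2 * (Complex.I * ħ) * discr ρ c' (a t)) -
          phaseA ρ (a t) * (2 * (Complex.I * ħ) * D')) /
            (2 * (Complex.I * ħ) * discr ρ c' (a t)) ^ 2 * u 0 ^ 2 +
        (2 * Complex.I * (-c' * a'.re + a'.imI) * (2 * (Complex.I * ħ) * discr ρ c' (a t)) -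
          phaseB c' (a t) * (2 * (Complex.I * ħ) * D')) /
            (2 * (Complex.I * ħ) * discr ρ c' (a t)) ^ 2 * (u 0 * u 1) +
        ((a'.re * ρ + a'.imJ - Complex.I * a'.imK) * (2 * (Complex.I * ħ) * discr ρ c' (a t)) -
          phaseC ρ (a t) * (2 * (Complex.I * ħ) * D')) /
            (2 * (Complex.I * ħ) * discr ρ c' (a t)) ^ 2 * u 1 ^ 2)) t := by
  have hne : discr ρ c' (a t) ≠ 0 := Complex.slitPlane_ne_zero hD
  have hj : 2 * (Complex.I * (ħ : ℂ)) * discr ρ c' (a t) ≠ 0 := by simp [hħ, hne]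
  have k0 := h0.ofReal_comp
  have k1 := h1.ofReal_comp
  have k2 := h2.ofReal_comp
  have k3 := h3.ofReal_comp
  have dD : HasDerivAt (fun s => discr ρ c' (a s)) D' t := by
    rw [hD']
    exact (((k0.const_mul _).const_add _).add (k1.const_mul _)).sub (k2.const_mul _)
  have dA : HasDerivAt (fun s => phaseA ρ (a s)) (a'.re * ρ + a'.imJ + Complex.I * a'.imK) t := by
    have := ((((k0.const_sub 1).neg).mul_const ρ).add k2).add (k3.const_mul Complex.I)
    exact this.congr_deriv (by simp)
  have dC : HasDerivAt (fun s => phaseC ρ (a s)) (a'.re * ρ + a'.imJ - Complex.I * a'.imK) t := by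
    have := ((((k0.const_sub 1).neg).mul_const ρ).add k2).sub (k3.const_mul Complex.I)
    exact this.congr_deriv (by simp)
  have dB : HasDerivAt (fun s => phaseB c' (a s)) (2 * Complex.I * (-c' * a'.re + a'.imI)) t := by
    have := (((k0.const_sub 1).const_mul c').add k1).const_mul (2 * Complex.I)
    exact this.congr_deriv (by simp)
  have dj := dD.const_mul (2 * (Complex.I * (ħ : ℂ)))
  exact (((((dD.clog_real hD).const_mul (-(1 / 2) : ℂ)).add ((dA.div dj hj).mul_const _)).add
    ((dB.div dj hj).mul_const _)).add ((dC.div dj hj).mul_const _)).cexp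

theorem analyticAt_starGauss (ħ : ℝ) (hħ : ħ ≠ 0) (ρ c' : ℂ) (b b' : ℍ[ℝ]) (T : ℝ) (t : ℝ)
    (u : Fin 2 → ℂ)
    (hD : discr ρ c' (Real.cos (t * T) • b + Real.sin (t * T) • b') ∈ Complex.slitPlane) :
    AnalyticAt ℝ (fun x : ℝ × (Fin 2 → ℂ) =>
      starGauss ħ ρ c' (Real.cos (x.1 * T) • b + Real.sin (x.1 * T) • b') x.2) (t, u) := by
  have hne := Complex.slitPlane_ne_zero hD
  have hof : ∀ (f : ℝ × (Fin 2 → ℂ) → ℝ), AnalyticAt ℝ f (t, u) →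
      AnalyticAt ℝ (fun x => (f x : ℂ)) (t, u) := fun f hf =>
    (Complex.ofRealCLM.analyticAt _).comp hf
  have hT : AnalyticAt ℝ (fun x : ℝ × (Fin 2 → ℂ) => x.1 * T) (t, u) :=
    analyticAt_fst.mul analyticAt_const
  have hc := (Real.analyticAt_cos (x := t * T)).comp_of_eq hT rfl
  have hs := (Real.analyticAt_sin (x := t * T)).comp_of_eq hT rfl
  have hlin : ∀ r s : ℝ, AnalyticAt ℝ (fun x : ℝ × (Fin 2 → ℂ) =>
      ((Real.cos (x.1 * T) * r + Real.sin (x.1 * T) * s : ℝ) : ℂ)) (t, u) := fun r s =>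
    hof _ ((hc.mul analyticAt_const).add (hs.mul analyticAt_const))
  have hu : ∀ i, AnalyticAt ℝ (fun x : ℝ × (Fin 2 → ℂ) => x.2 i) (t, u) := fun i =>
    ((ContinuousLinearMap.proj (R := ℝ) (φ := fun _ : Fin 2 => ℂ) i).analyticAt _).comp
      analyticAt_snd
  have k0 := hlin b.re b'.re
  have k1 := hlin b.imI b'.imI
  have k2 := hlin b.imJ b'.imJ
  have k3 := hlin b.imK b'.imK
  have dD : AnalyticAt ℝ (fun x : ℝ × (Fin 2 → ℂ) =>
      discr ρ c' (Real.cos (x.1 * T) • b + Real.sin (x.1 * T) • b')) (t, u) :=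
    ((analyticAt_const.add (analyticAt_const.mul k0)).add (analyticAt_const.mul k1)).sub
      (analyticAt_const.mul k2)
  have dA : AnalyticAt ℝ (fun x : ℝ × (Fin 2 → ℂ) =>
      phaseA ρ (Real.cos (x.1 * T) • b + Real.sin (x.1 * T) • b')) (t, u) :=
    ((((analyticAt_const.sub k0).neg).mul analyticAt_const).add k2).add (analyticAt_const.mul k3)
  have dC : AnalyticAt ℝ (fun x : ℝ × (Fin 2 → ℂ) =>
      phaseC ρ (Real.cos (x.1 * T) • b + Real.sin (x.1 * T) • b')) (t, u) :=
    ((((analyticAt_const.sub k0).neg).mul analyticAt_const).add k2).sub (analyticAt_const.mul k3)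
  have dB : AnalyticAt ℝ (fun x : ℝ × (Fin 2 → ℂ) =>
      phaseB c' (Real.cos (x.1 * T) • b + Real.sin (x.1 * T) • b')) (t, u) :=
    analyticAt_const.mul ((analyticAt_const.mul (analyticAt_const.sub k0)).add k1)
  have hj : 2 * (Complex.I * (ħ : ℂ)) *
      discr ρ c' (Real.cos (t * T) • b + Real.sin (t * T) • b') ≠ 0 := by simp [hħ, hne]
  have dj := (analyticAt_const (v := 2 * (Complex.I * (ħ : ℂ)))).mul dD
  have hlog := ((analyticAt_clog hD).restrictScalars (𝕜 := ℝ)).comp_of_eq dD rfl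
  exact (analyticAt_cexp.restrictScalars (𝕜 := ℝ)).comp
    ((((analyticAt_const.mul hlog).add ((dA.div dj hj).mul ((hu 0).pow 2))).add
      ((dB.div dj hj).mul ((hu 0).mul (hu 1)))).add ((dC.div dj hj).mul ((hu 1).pow 2)))

/-- The hypotheses `h1` and `h2` say that multiplication by `n` acts on `b, b'` as a quarter turn,
so the path is the orbit of `b` under the one-parameter group of `n`. The condition `hD` makes the
logarithm in the amplitude analytic along the whole circle. -/
theorem evolvesTo_starGauss {ħ : ℝ} (hħ : ħ ≠ 0) {ρ c' : ℂ} {σ : ℝ} (hσ : σ = 1 ∨ σ = -1)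
    {n b b' : ℍ[ℝ]} {T : ℝ}
    (hb : ∀ s, (Real.cos s * b.re + Real.sin s * b'.re) ^ 2 +
      (Real.cos s * b.imI + Real.sin s * b'.imI) ^ 2 +
      (Real.cos s * b.imJ + Real.sin s * b'.imJ) ^ 2 +
      (Real.cos s * b.imK + Real.sin s * b'.imK) ^ 2 = 1)
    (h1 : b' = signedMul σ n b) (h2 : -b = signedMul σ n b')
    (hD : ∀ s, discr ρ c' (Real.cos s • b + Real.sin s • b') ∈ Complex.slitPlane) :
    EvolvesTo ħ (signedMatrix ρ c' σ) (hamiltonian ħ ρ c' (T • n)) (starGauss ħ ρ c' b)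
      (starGauss ħ ρ c' (Real.cos T • b + Real.sin T • b')) := by
  have key : IsStarEvolution ħ (signedMatrix ρ c' σ) (hamiltonian ħ ρ c' (T • n))
      (starGauss ħ ρ c' b)
      (fun t => starGauss ħ ρ c' (Real.cos (t * T) • b + Real.sin (t * T) • b')) := by
    refine ⟨fun x _ => ?_, fun t _ => differentiable_gauss _ _ _ _, fun t _ u => ?_, by simp⟩
    · exact analyticAt_starGauss ħ hħ ρ c' b b' T x.1 x.2 (hD _)
    · have hc : HasDerivAt (fun s : ℝ => Real.cos (s * T)) (-Real.sin (t * T) * T) t := by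
        simpa using ((hasDerivAt_id t).mul_const T).cos
      have hs : HasDerivAt (fun s : ℝ => Real.sin (s * T)) (Real.cos (t * T) * T) t := by
        simpa using ((hasDerivAt_id t).mul_const T).sin
      have hd : ∀ x y z : ℝ, -Real.sin (t * T) * T * x + Real.cos (t * T) * T * y = z →
          HasDerivAt (fun s : ℝ => Real.cos (s * T) * x + Real.sin (s * T) * y) z t := by
        rintro x y z rfl
        exact (hc.mul_const x).add (hs.mul_const y)
      have e2 := fun f : ℍ[ℝ] → ℝ => congrArg f h2
      have q0 := e2 (·.re)
      have q1 := e2 (·.imI)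
      have q2 := e2 (·.imJ)
      have q3 := e2 (·.imK)
      have e1 := fun f : ℍ[ℝ] → ℝ => congrArg f h1
      have r0 := e1 (·.re)
      have r1 := e1 (·.imI)
      have r2 := e1 (·.imJ)
      have r3 := e1 (·.imK)
      simp only [signedMul, Quaternion.re_neg, Quaternion.imI_neg, Quaternion.imJ_neg,
        Quaternion.imK_neg] at q0 q1 q2 q3 r0 r1 r2 r3
      rw [starMul_hamiltonian hħ hσ (hb _) rfl (Complex.slitPlane_ne_zero (hD _)) u rfl]
      -- Componentwise, the velocity of the path is the signed product of `T • n` with the path, by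
      -- `r0`–`r3` for the cosine part and `q0`–`q3` for the sine part.
      refine hasDerivAt_starGauss
        (a := fun s => Real.cos (s * T) • b + Real.sin (s * T) • b') hħ (hd _ _ _ ?_) (hd _ _ _ ?_)
        (hd _ _ _ ?_) (hd _ _ _ ?_) (hD _) u rfl
      · simp [signedMul]
        linear_combination Real.sin (t * T) * T * q0 + Real.cos (t * T) * T * r0
      · simp [signedMul]
        linear_combination Real.sin (t * T) * T * q1 + Real.cos (t * T) * T * r1
      · simp [signedMul]
        linear_combination Real.sin (t * T) * T * q2 + Real.cos (t * T) * T * r2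
      · simp [signedMul]
        linear_combination Real.sin (t * T) * T * q3 + Real.cos (t * T) * T * r3
  have := key.evolvesTo
  simpa using this

end StarGauss

/-! ### The discriminant avoids the branch cut, and the Gaussians are independent. -/

section Discriminant

/-- Multiplied by `2 * (1 - a.re)`, the real part becomes a sum of three squares minus `θ ^ 2 * (1 -
a.re) ^ 2`, while the imaginary part is `θ` times the base of the first square. On the branch cut
the first square must be compensated by `θ`. If `a.imI = 0` this contradicts `c ≠ 0`; if `a.imJ = 0`
it contradicts `|θ| < |ρ|`. -/
theorem discr_mem_slitPlane {ρ c θ : ℝ} (hθ : |θ| < |ρ|) (hc : c ≠ 0) {a : ℍ[ℝ]}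
    (ha : a.re ^ 2 + a.imI ^ 2 + a.imJ ^ 2 + a.imK ^ 2 = 1)
    (h : a.imI = 0 ∨ a.imJ = 0 ∨ (a.re = 0 ∧ a.imK = 0 ∧
      ¬ ((|ρ| - |θ|) ^ 2 + c ^ 2 ≤ 1 ∧ 1 ≤ (|ρ| + |θ|) ^ 2 + c ^ 2))) :
    discr ρ (c + Complex.I * θ) a ∈ Complex.slitPlane := by
  obtain ⟨a0, a1, a2, a3⟩ := a
  simp only at ha h
  have e : discr ρ (c + Complex.I * θ) ⟨a0, a1, a2, a3⟩ =
      ((1 + (ρ ^ 2 + c ^ 2 - θ ^ 2)) / 2 + (1 - (ρ ^ 2 + c ^ 2 - θ ^ 2)) / 2 * a0 + c * a1 -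
        ρ * a2 : ℝ) + (θ * (c * (1 - a0) + a1) : ℝ) * Complex.I := by
    simp only [discr]; push_cast
    linear_combination ((1 - a0) * θ ^ 2 / 2 : ℂ) * Complex.I_sq
  rw [e, Complex.mem_slitPlane_iff]
  by_contra! hn
  obtain ⟨hre, him⟩ := hn
  simp only [Complex.add_re, Complex.add_im, Complex.ofReal_re, Complex.ofReal_im, Complex.mul_re,
    Complex.mul_im, Complex.I_re, Complex.I_im, mul_zero, mul_one, zero_add, add_zero,
    sub_zero] at hre him
  have hsq : 0 < ρ ^ 2 - θ ^ 2 := sub_pos.2 (sq_lt_sq.2 hθ)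
  have key : 2 * (1 - a0) * ((1 + (ρ ^ 2 + c ^ 2 - θ ^ 2)) / 2 +
      (1 - (ρ ^ 2 + c ^ 2 - θ ^ 2)) / 2 * a0 + c * a1 - ρ * a2) =
      (c * (1 - a0) + a1) ^ 2 + (ρ * (1 - a0) - a2) ^ 2 + a3 ^ 2 - θ ^ 2 * (1 - a0) ^ 2 := by
    linear_combination -ha
  have h1 : a0 ≤ 1 := by nlinarith
  rcases h1.eq_or_lt with rfl | h1
  · have h2 : a1 = 0 := by nlinarith
    have h3 : a2 = 0 := by nlinarith
    subst h2 h3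
    linarith
  have hle : (c * (1 - a0) + a1) ^ 2 + (ρ * (1 - a0) - a2) ^ 2 + a3 ^ 2 - θ ^ 2 * (1 - a0) ^ 2 ≤ 0 := by
    rw [← key]; exact mul_nonpos_of_nonneg_of_nonpos (by linarith) hre
  have hp : 0 < (1 - a0) ^ 2 := by have := sub_pos.2 h1; positivity
  rcases h with rfl | rfl | ⟨rfl, rfl, h⟩
  · rcases mul_eq_zero.1 him with rfl | h2
    · have : 0 < c ^ 2 * (1 - a0) ^ 2 := by positivity
      nlinarith [sq_nonneg (ρ * (1 - a0) - a2), sq_nonneg a3]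
    · have : (1 - a0) = 0 := by simpa [hc] using h2
      rw [this] at hp; simp at hp
  · nlinarith [sq_nonneg (c * (1 - a0) + a1), sq_nonneg a3, mul_pos hsq hp]
  · refine h ?_
    -- On the circle through `i` and `j`, hitting the cut forces `a1 = -c`, hence `a2 ^ 2 = 1 - c ^
    -- 2`, with `a2` within `|θ|` of `ρ`. This is what the excluded inequalities describe.
    have h2 : (c + a1) ^ 2 = 0 ∧ (ρ - a2) ^ 2 ≤ θ ^ 2 := by
      rcases mul_eq_zero.1 him with rfl | h2
      · constructor <;> nlinarith [sq_nonneg (c + a1), sq_nonneg (ρ - a2)]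
      · constructor <;> nlinarith
    have h3 : a1 = -c := by have := pow_eq_zero_iff (two_ne_zero) |>.1 h2.1; linarith
    have h4 : |ρ - a2| ≤ |θ| := sq_le_sq.1 h2.2
    have h5 : a2 ^ 2 = 1 - c ^ 2 := by rw [h3] at ha; linarith
    have h6 : |ρ| - |θ| ≤ |a2| := by have := abs_sub_abs_le_abs_sub ρ a2; linarith
    have h7 : |a2| ≤ |ρ| + |θ| := by
      have := abs_sub_abs_le_abs_sub a2 ρ
      rw [abs_sub_comm] at this; linarith
    have h8 : (|ρ| - |θ|) ^ 2 ≤ |a2| ^ 2 := pow_le_pow_left₀ (by linarith) h6 2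
    have h9 : |a2| ^ 2 ≤ (|ρ| + |θ|) ^ 2 := pow_le_pow_left₀ (abs_nonneg _) h7 2
    rw [sq_abs] at h8 h9
    constructor <;> linarith

theorem one_add_det_ne_zero {ρ c θ : ℝ} (hθ : |θ| < |ρ|) :
    1 + ((ρ : ℂ) ^ 2 + (c + Complex.I * θ) ^ 2) ≠ 0 := by
  intro h
  have h1 := congrArg Complex.re h
  simp [pow_two] at h1
  have hsq : 0 < ρ ^ 2 - θ ^ 2 := sub_pos.2 (sq_lt_sq.2 hθ)
  nlinarith [sq_nonneg c]

/-- The unit norm gives a relation, quadratic in the numerators and `discr`, that expresses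
`discr⁻¹` as a polynomial in the phase coefficients. So the phase determines `discr`, then the
numerators, and these fix the quaternion by linear equations solvable because `1 + det K ≠ 0`. -/
theorem phase_injective {ρ c' : ℂ} (hδ : 1 + (ρ ^ 2 + c' ^ 2) ≠ 0) {a b : ℍ[ℝ]}
    (ha : a.re ^ 2 + a.imI ^ 2 + a.imJ ^ 2 + a.imK ^ 2 = 1)
    (hb : b.re ^ 2 + b.imI ^ 2 + b.imJ ^ 2 + b.imK ^ 2 = 1)
    (hDa : discr ρ c' a ≠ 0) (hDb : discr ρ c' b ≠ 0)
    (hA : phaseA ρ a / discr ρ c' a = phaseA ρ b / discr ρ c' b)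
    (hB : phaseB c' a / discr ρ c' a = phaseB c' b / discr ρ c' b)
    (hC : phaseC ρ a / discr ρ c' a = phaseC ρ b / discr ρ c' b) : a = b := by
  have key : ∀ {a : ℍ[ℝ]}, a.re ^ 2 + a.imI ^ 2 + a.imJ ^ 2 + a.imK ^ 2 = 1 →
      discr ρ c' a ≠ 0 → discr ρ c' a * (1 + 1 / 2 * (ρ * (phaseA ρ a / discr ρ c' a +
        phaseC ρ a / discr ρ c' a) + Complex.I * c' * (phaseB c' a / discr ρ c' a)) +
        1 / 4 * (1 + (ρ ^ 2 + c' ^ 2)) * (phaseA ρ a / discr ρ c' a * (phaseC ρ a / discr ρ c' a) -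
          (phaseB c' a / discr ρ c' a) ^ 2 / 4)) = 1 := by
    intro a ha hD
    have ha' : (a.re : ℂ) ^ 2 + a.imI ^ 2 + a.imJ ^ 2 + a.imK ^ 2 = 1 := by exact_mod_cast ha
    have e : discr ρ c' a ^ 2 + 1 / 2 * (ρ * (phaseA ρ a + phaseC ρ a) +
        Complex.I * c' * phaseB c' a) * discr ρ c' a + 1 / 4 * (1 + (ρ ^ 2 + c' ^ 2)) *
        (phaseA ρ a * phaseC ρ a - phaseB c' a ^ 2 / 4) = discr ρ c' a := by
      have e1 : Complex.I * c' * phaseB c' a = -2 * c' * (c' * (1 - a.re) + a.imI) := by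
        rw [phaseB]
        linear_combination 2 * c' * (c' * (1 - a.re) + a.imI) * Complex.I_sq
      have e2 : phaseB c' a ^ 2 = -4 * (c' * (1 - a.re) + a.imI) ^ 2 := by
        rw [phaseB]
        linear_combination 4 * (c' * (1 - a.re) + a.imI) ^ 2 * Complex.I_sq
      have e3 : phaseA ρ a * phaseC ρ a = (-(1 - a.re) * ρ + a.imJ) ^ 2 + a.imK ^ 2 := by
        rw [phaseA, phaseC]
        linear_combination -(a.imK : ℂ) ^ 2 * Complex.I_sq
      rw [e1, e2, e3, phaseA, phaseC, discr]
      linear_combination (1 / 4 * (1 + (ρ ^ 2 + c' ^ 2))) * ha'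
    field_simp
    linear_combination 32 * e
  have hD : discr ρ c' a = discr ρ c' b := by
    have h1 := key ha hDa
    have h2 := key hb hDb
    rw [hA, hB, hC] at h1
    exact mul_right_cancel₀ (right_ne_zero_of_mul_eq_one h2) (h1.trans h2.symm)
  rw [hD, div_left_inj' hDb] at hA hB hC
  have hI := Complex.I_ne_zero
  rw [phaseA, phaseA] at hA
  rw [phaseC, phaseC] at hC
  rw [phaseB, phaseB] at hB
  rw [discr, discr] at hD
  have h3 : (a.imK : ℂ) = b.imK := mul_left_cancel₀ hI (by linear_combination (hA - hC) / 2)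
  have hB' := mul_left_cancel₀ (mul_ne_zero two_ne_zero hI) hB
  have h0 : (a.re : ℂ) = b.re := by
    refine mul_left_cancel₀ hδ ?_
    linear_combination 2 * hD - 2 * c' * hB' + ρ * (hA + hC)
  have h1 : (a.imI : ℂ) = b.imI := by linear_combination hB' + c' * h0
  have h2 : (a.imJ : ℂ) = b.imJ := by linear_combination (hA + hC) / 2 - ρ * h0
  exact Quaternion.ext _ _ (by exact_mod_cast h0) (by exact_mod_cast h1) (by exact_mod_cast h2)
    (by exact_mod_cast h3)

/-- On a line `v = m u` where the quadratic forms take distinct values, the Gaussians become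
multiples of distinct exponentials in `u ^ 2`, that is, of distinct characters of the additive group
`ℂ`; Dedekind's theorem applies. -/
theorem linearIndependent_gauss {κ : Type*} [Finite κ] (l A B C : κ → ℂ)
    (h : Function.Injective fun i => (A i, B i, C i)) :
    LinearIndependent ℂ fun i => gauss (l i) (A i) (B i) (C i) := by
  classical
  have := Fintype.ofFinite κ
  let P : κ → Polynomial ℂ := fun i =>
    Polynomial.C (A i) + Polynomial.C (B i) * Polynomial.X + Polynomial.C (C i) * Polynomial.X ^ 2
  have hP : Function.Injective P := by
    intro i j hij
    have hc := fun n => congrArg (Polynomial.coeff · n) hij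
    have h0 := hc 0
    have h1 := hc 1
    have h2 := hc 2
    simp [P, Polynomial.coeff_X, Polynomial.coeff_C, Polynomial.coeff_X_pow] at h0 h1 h2
    exact h (by simp [h0, h1, h2])
  -- The slope `m` avoids the roots of the finitely many nonzero differences of the polynomials `P
  -- i`.
  obtain ⟨m, hm⟩ : ∃ m, (∏ x ∈ (Finset.univ : Finset κ).offDiag, (P x.1 - P x.2)).eval m ≠ 0 := by
    by_contra! hm
    have h0 := Polynomial.zero_of_eval_zero _ hm
    obtain ⟨x, hx, hx'⟩ := Finset.prod_eq_zero_iff.1 h0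
    exact (Finset.mem_offDiag.1 hx).2.2 (hP (sub_eq_zero.1 hx'))
  have hm' : Function.Injective fun i => (P i).eval m := by
    intro i j hij
    by_contra hne
    refine hm ?_
    rw [Polynomial.eval_prod]
    exact Finset.prod_eq_zero (i := (i, j)) (by simp [hne]) (by simpa [sub_eq_zero] using hij)
  let χ : κ → (Multiplicative ℂ →* ℂ) := fun i =>
    { toFun := fun r => Complex.exp ((P i).eval m * r.toAdd)
      map_one' := by simp
      map_mul' := fun r s => by simp [mul_add, Complex.exp_add] }
  have hχ : Function.Injective χ := by
    intro i j hij
    refine hm' (sub_eq_zero.1 ?_)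
    by_contra hne
    beta_reduce at hne
    -- At the inverse of the difference of the two exponents, equal characters would give `exp 1 =
    -- 1`.
    have h1 := DFunLike.congr_fun hij (Multiplicative.ofAdd ((P i).eval m - (P j).eval m)⁻¹)
    simp only [χ, MonoidHom.coe_mk, OneHom.coe_mk, toAdd_ofAdd] at h1
    have h2 : Complex.exp 1 = 1 := by
      have h3 := mul_inv_cancel₀ hne
      rw [sub_mul] at h3
      rw [← h3, Complex.exp_sub, h1, div_self (Complex.exp_ne_zero _), h3]
    have h3 : Real.exp 1 = 1 := Complex.ofReal_injective (by simpa using h2)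
    have := Real.add_one_le_exp 1
    linarith
  have hli := (linearIndependent_monoidHom (Multiplicative ℂ) ℂ).comp χ hχ
  rw [Fintype.linearIndependent_iff] at hli ⊢
  intro g hg i
  have := hli (fun i => g i * Complex.exp (l i)) (by
    funext r
    obtain ⟨w, hw⟩ := IsAlgClosed.exists_pow_nat_eq r.toAdd zero_lt_two
    have h1 := congrFun hg ![w, m * w]
    simp only [Finset.sum_apply, Pi.smul_apply, smul_eq_mul, Pi.zero_apply, gauss,
      Function.comp_apply] at h1 ⊢
    rw [← h1]
    refine Finset.sum_congr rfl fun i _ => ?_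
    simp only [χ, MonoidHom.coe_mk, OneHom.coe_mk, ← hw, mul_assoc, ← Complex.exp_add]
    congr 2
    simp [P]
    ring) i
  exact (mul_eq_zero.1 this).resolve_right (Complex.exp_ne_zero _)

theorem linearIndependent_starGauss {κ : Type*} [Finite κ] {ħ : ℝ} (hħ : ħ ≠ 0) {ρ c' : ℂ}
    (hδ : 1 + (ρ ^ 2 + c' ^ 2) ≠ 0) {a : κ → ℍ[ℝ]} (hinj : Function.Injective a)
    (ha : ∀ i, (a i).re ^ 2 + (a i).imI ^ 2 + (a i).imJ ^ 2 + (a i).imK ^ 2 = 1)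
    (hD : ∀ i, discr ρ c' (a i) ≠ 0) :
    LinearIndependent ℂ fun i => starGauss ħ ρ c' (a i) := by
  refine linearIndependent_gauss _ _ _ _ fun i j hij => hinj ?_
  have hj : 2 * (Complex.I * (ħ : ℂ)) ≠ 0 := by simp [hħ]
  simp only [Prod.mk.injEq] at hij
  have e : ∀ X Y D D' : ℂ, X / (2 * (Complex.I * (ħ : ℂ)) * D) =
      Y / (2 * (Complex.I * (ħ : ℂ)) * D') → X / D = Y / D' := by
    intro X Y D D' h
    have h2 := congrArg (2 * (Complex.I * (ħ : ℂ)) * ·) h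
    simpa only [← mul_div_assoc, mul_div_mul_left _ _ hj] using h2
  exact phase_injective hδ (ha i) (ha j) (hD i) (hD j) (e _ _ _ _ hij.1) (e _ _ _ _ hij.2.1)
    (e _ _ _ _ hij.2.2)

end Discriminant

/-! ### Evolution between elements of the quaternion group. -/

section QuaternionGroup

/-- The quaternions `1, i, j, k`. -/
noncomputable def quatUnit : Fin 4 → ℍ[ℝ] :=
  ![⟨1, 0, 0, 0⟩, ⟨0, 1, 0, 0⟩, ⟨0, 0, 1, 0⟩, ⟨0, 0, 0, 1⟩]

theorem quatUnit_components (k : Fin 4) : (quatUnit k).re = ![1, 0, 0, 0] k ∧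
    (quatUnit k).imI = ![0, 1, 0, 0] k ∧ (quatUnit k).imJ = ![0, 0, 1, 0] k ∧
    (quatUnit k).imK = ![0, 0, 0, 1] k := by
  fin_cases k <;> exact ⟨rfl, rfl, rfl, rfl⟩

theorem quatUnit_zero : quatUnit 0 = 1 := rfl

/-- The index of the product of two of the quaternions `1, i, j, k`. -/
def unitIdx : Fin 4 → Fin 4 → Fin 4 :=
  ![![0, 1, 2, 3], ![1, 0, 3, 2], ![2, 3, 0, 1], ![3, 2, 1, 0]]

/-- The sign of the product of two of the quaternions `1, i, j, k`. -/
noncomputable def unitSign : Fin 4 → Fin 4 → ℝ :=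
  ![![1, 1, 1, 1], ![1, -1, 1, -1], ![1, -1, -1, 1], ![1, 1, -1, -1]]

theorem unit_zero_left (k : Fin 4) : unitSign 0 k = 1 ∧ unitIdx 0 k = k := by
  fin_cases k <;> exact ⟨rfl, rfl⟩

theorem unit_zero_right (k : Fin 4) : unitSign k 0 = 1 ∧ unitIdx k 0 = k := by
  fin_cases k <;> exact ⟨rfl, rfl⟩

theorem quatUnit_mul (n k : Fin 4) :
    quatUnit n * quatUnit k = unitSign n k • quatUnit (unitIdx n k) := by
  fin_cases n <;> fin_cases k <;> ext <;> simp [quatUnit_components, unitIdx, unitSign]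

theorem unitSign_eq (n k : Fin 4) : unitSign n k = 1 ∨ unitSign n k = -1 := by
  fin_cases n <;> fin_cases k <;> simp [unitSign]

theorem quatUnit_mul_self {n : Fin 4} (hn : n ≠ 0) : quatUnit n * quatUnit n = -1 := by
  fin_cases n <;> first | exact absurd rfl hn | (ext <;> simp [quatUnit_components])

theorem quatUnit_re {n : Fin 4} (hn : n ≠ 0) : (quatUnit n).re = 0 := by
  fin_cases n <;> first | exact absurd rfl hn | simp [quatUnit_components]

/-- The Klein four-group. -/
abbrev KleinFour : Type := Multiplicative (ZMod 2 × ZMod 2)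

/-- The elements of the Klein four-group, in the order of the quaternions `1, i, j, k`. -/
noncomputable def kleinEquiv : Fin 4 ≃ KleinFour :=
  Equiv.ofBijective ![Multiplicative.ofAdd (0, 0), Multiplicative.ofAdd (1, 0),
    Multiplicative.ofAdd (0, 1), Multiplicative.ofAdd (1, 1)] (by decide)

theorem kleinEquiv_mul (n k : Fin 4) :
    kleinEquiv n * kleinEquiv k = kleinEquiv (unitIdx n k) := by
  fin_cases n <;> fin_cases k <;> rfl

theorem signedMul_one {n : ℍ[ℝ]} (hn : n.re = 0) (a : ℍ[ℝ]) : signedMul 1 n a = n * a := by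
  ext <;> simp [signedMul, hn] <;> ring

theorem signedMul_neg_one {n : ℍ[ℝ]} (hn : n.re = 0) (a : ℍ[ℝ]) : signedMul (-1) n a = a * n := by
  ext <;> simp [signedMul, hn] <;> ring

theorem quatUnit_path_normSq {k m : Fin 4} (hkm : k ≠ m) (α β : ℝ) :
    (α • quatUnit k + β • quatUnit m).re ^ 2 + (α • quatUnit k + β • quatUnit m).imI ^ 2 +
      (α • quatUnit k + β • quatUnit m).imJ ^ 2 + (α • quatUnit k + β • quatUnit m).imK ^ 2 =
      α ^ 2 + β ^ 2 := by
  fin_cases k <;> fin_cases m <;> first | exact absurd rfl hkm | (simp [quatUnit_components]; try ring)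

theorem discr_quatUnit_mem_slitPlane {ρ c θ : ℝ} (hθ : |θ| < |ρ|) (hc : c ≠ 0) {k m : Fin 4}
    (hkm : k ≠ m) (h : (k = 1 ∧ m = 2 ∨ k = 2 ∧ m = 1) →
      ¬ ((|ρ| - |θ|) ^ 2 + c ^ 2 ≤ 1 ∧ 1 ≤ (|ρ| + |θ|) ^ 2 + c ^ 2)) {α β : ℝ}
    (hαβ : α ^ 2 + β ^ 2 = 1) :
    discr ρ (c + Complex.I * θ) (α • quatUnit k + β • quatUnit m) ∈ Complex.slitPlane := by
  refine discr_mem_slitPlane hθ hc ((quatUnit_path_normSq hkm α β).trans hαβ) ?_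
  by_cases hkm' : k = 1 ∧ m = 2 ∨ k = 2 ∧ m = 1
  · refine .inr (.inr ⟨?_, ?_, h hkm'⟩) <;>
      rcases hkm' with ⟨rfl, rfl⟩ | ⟨rfl, rfl⟩ <;> simp [quatUnit_components]
  · clear h
    fin_cases k <;> fin_cases m <;> simp_all [quatUnit_components]

theorem unitIdx_ne {n : Fin 4} (hn : n ≠ 0) (k : Fin 4) : k ≠ unitIdx n k ∧ k ≠ unitIdx k n := by
  revert n k; decide

/-- The exceptional circle through `i` and `j` occurs only for multiplication by `k`, starting from
`i` or `j`. -/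
theorem unitIdx_pair {n : Fin 4} (hn : n ≠ 0) (k : Fin 4) :
    (k = 1 ∧ unitIdx n k = 2 ∨ k = 2 ∧ unitIdx n k = 1 → n = 3 ∧ (k = 1 ∨ k = 2)) ∧
    (k = 1 ∧ unitIdx k n = 2 ∨ k = 2 ∧ unitIdx k n = 1 → n = 3 ∧ (k = 1 ∨ k = 2)) := by
  revert n k; decide

variable {ħ ρ c θ : ℝ}

theorem evolvesTo_starGauss_quatUnit (hħ : ħ ≠ 0) (hθ : |θ| < |ρ|) (hc : c ≠ 0)
    {n k m : Fin 4} {σ s t : ℝ} (hσ : σ = 1 ∨ σ = -1) (hs : s = 1 ∨ s = -1) (ht : t = 1 ∨ t = -1)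
    (hkm : k ≠ m) (h : (k = 1 ∧ m = 2 ∨ k = 2 ∧ m = 1) →
      ¬ ((|ρ| - |θ|) ^ 2 + c ^ 2 ≤ 1 ∧ 1 ≤ (|ρ| + |θ|) ^ 2 + c ^ 2))
    (h1 : t • quatUnit m = signedMul σ (quatUnit n) (s • quatUnit k))
    (h2 : -(s • quatUnit k) = signedMul σ (quatUnit n) (t • quatUnit m)) (T : ℝ) :
    EvolvesTo ħ (signedMatrix ρ (c + Complex.I * θ) σ)
      (hamiltonian ħ ρ (c + Complex.I * θ) (T • quatUnit n))
      (starGauss ħ ρ (c + Complex.I * θ) (s • quatUnit k))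
      (starGauss ħ ρ (c + Complex.I * θ)
        (Real.cos T • s • quatUnit k + Real.sin T • t • quatUnit m)) := by
  have hst : ∀ r, (Real.cos r * s) ^ 2 + (Real.sin r * t) ^ 2 = 1 := by
    intro r
    rcases hs with rfl | rfl <;> rcases ht with rfl | rfl <;> simp
  refine evolvesTo_starGauss hħ hσ (fun r => ?_) h1 h2 fun r => ?_
  · have := (quatUnit_path_normSq hkm (Real.cos r * s) (Real.sin r * t)).trans (hst r)
    rw [mul_smul, mul_smul] at this
    exact this
  · rw [smul_smul, smul_smul]
    exact discr_quatUnit_mem_slitPlane hθ hc hkm h (hst r)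

theorem evolvesTo_left (hħ : ħ ≠ 0) (hθ : |θ| < |ρ|) (hc : c ≠ 0) {n k : Fin 4} {s : ℝ}
    (hs : s = 1 ∨ s = -1) (hn : n ≠ 0) (h : n = 3 ∧ (k = 1 ∨ k = 2) →
      ¬ ((|ρ| - |θ|) ^ 2 + c ^ 2 ≤ 1 ∧ 1 ≤ (|ρ| + |θ|) ^ 2 + c ^ 2)) (T : ℝ) :
    EvolvesTo ħ (signedMatrix ρ (c + Complex.I * θ) (1 : ℝ))
      (hamiltonian ħ ρ (c + Complex.I * θ) (T • quatUnit n))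
      (starGauss ħ ρ (c + Complex.I * θ) (s • quatUnit k))
      (starGauss ħ ρ (c + Complex.I * θ)
        (Real.cos T • s • quatUnit k + Real.sin T • (s * unitSign n k) • quatUnit (unitIdx n k))) := by
  have e : (s * unitSign n k) • quatUnit (unitIdx n k) = quatUnit n * s • quatUnit k := by
    rw [mul_smul, ← quatUnit_mul, mul_smul_comm]
  refine evolvesTo_starGauss_quatUnit hħ hθ hc (.inl rfl) hs ?_ (unitIdx_ne hn k).1
    (fun h' => h ((unitIdx_pair hn k).1 h')) ?_ ?_ T
  · rcases hs with rfl | rfl <;> rcases unitSign_eq n k with h | h <;> simp [h]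
  · rw [signedMul_one (quatUnit_re hn), e]
  · rw [signedMul_one (quatUnit_re hn), e, ← mul_assoc, quatUnit_mul_self hn, neg_one_mul]

theorem evolvesTo_right (hħ : ħ ≠ 0) (hθ : |θ| < |ρ|) (hc : c ≠ 0) {n k : Fin 4} {s : ℝ}
    (hs : s = 1 ∨ s = -1) (hn : n ≠ 0) (h : n = 3 ∧ (k = 1 ∨ k = 2) →
      ¬ ((|ρ| - |θ|) ^ 2 + c ^ 2 ≤ 1 ∧ 1 ≤ (|ρ| + |θ|) ^ 2 + c ^ 2)) (T : ℝ) :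
    EvolvesTo ħ (signedMatrix ρ (c + Complex.I * θ) (-1 : ℝ))
      (hamiltonian ħ ρ (c + Complex.I * θ) (T • quatUnit n))
      (starGauss ħ ρ (c + Complex.I * θ) (s • quatUnit k))
      (starGauss ħ ρ (c + Complex.I * θ)
        (Real.cos T • s • quatUnit k + Real.sin T • (s * unitSign k n) • quatUnit (unitIdx k n))) := by
  have e : (s * unitSign k n) • quatUnit (unitIdx k n) = (s • quatUnit k) * quatUnit n := by
    rw [mul_smul, ← quatUnit_mul, smul_mul_assoc]
  refine evolvesTo_starGauss_quatUnit hħ hθ hc (.inr rfl) hs ?_ (unitIdx_ne hn k).2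
    (fun h' => h ((unitIdx_pair hn k).2 h')) ?_ ?_ T
  · rcases hs with rfl | rfl <;> rcases unitSign_eq k n with h | h <;> simp [h]
  · rw [signedMul_neg_one (quatUnit_re hn), e]
  · rw [signedMul_neg_one (quatUnit_re hn), e, mul_assoc, quatUnit_mul_self hn, mul_neg_one]

theorem Kre_add_skewJ (ρ : ℝ) (c' : ℂ) : Kre ρ c' + skewJ = signedMatrix ρ c' (1 : ℝ) := by
  ext i j; fin_cases i <;> fin_cases j <;> simp [Kre, skewJ, signedMatrix, sub_eq_add_neg]

theorem Kre_add_skewJ_transpose (ρ : ℝ) (c' : ℂ) :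
    (Kre ρ c' + skewJ).transpose = signedMatrix ρ c' (-1 : ℝ) := by
  ext i j; fin_cases i <;> fin_cases j <;> simp [Kre, skewJ, signedMatrix, sub_eq_add_neg]

/-- Symmetrizing cancels the skew part `J`, so only `K` contributes to the constants. -/
theorem symProd_Kre (ħ ρ : ℝ) (c' : ℂ) :
    symProd ħ (Kre ρ c') 0 0 = quadPoly 1 0 0 (Complex.I * ħ / 2 * ρ) ∧
    symProd ħ (Kre ρ c') 0 1 = quadPoly 0 1 0 (Complex.I * ħ / 2 * (Complex.I * c')) ∧
    symProd ħ (Kre ρ c') 1 1 = quadPoly 0 0 1 (Complex.I * ħ / 2 * ρ) := by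
  have e : ∀ i j (z w : ℂ), (1 / 2 : ℂ) • ((MvPolynomial.X i * MvPolynomial.X j +
      MvPolynomial.C z) + (MvPolynomial.X j * MvPolynomial.X i + MvPolynomial.C w)) =
      (MvPolynomial.X i * MvPolynomial.X j + MvPolynomial.C ((z + w) / 2) : PolySymb) := by
    intro i j z w
    rw [mul_comm (MvPolynomial.X j), MvPolynomial.smul_eq_C_mul, div_eq_inv_mul (z + w),
      MvPolynomial.C_mul, MvPolynomial.C_add]
    have : (MvPolynomial.C (1 / 2 : ℂ) : PolySymb) * 2 = 1 := by
      rw [show (2 : PolySymb) = MvPolynomial.C 2 from rfl, ← MvPolynomial.C_mul]; norm_num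
    rw [← one_div]
    linear_combination MvPolynomial.X i * MvPolynomial.X j * this
  refine ⟨?_, ?_, ?_⟩ <;> rw [symProd, Kre_add_skewJ] <;> simp only [polyStar_X_X, e, quadPoly]
  · simp [signedMatrix, pow_two]
  · simp [signedMatrix]
    simp only [← MvPolynomial.C_mul]
    congr 1; ring
  · simp [signedMatrix, pow_two]

theorem smul_quadPoly (z α β γ κ : ℂ) :
    z • quadPoly α β γ κ = quadPoly (z * α) (z * β) (z * γ) (z * κ) := by
  simp only [quadPoly, MvPolynomial.smul_eq_C_mul, MvPolynomial.C_mul]; ring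

theorem neg_quadPoly (α β γ κ : ℂ) : -quadPoly α β γ κ = quadPoly (-α) (-β) (-γ) (-κ) := by
  simp only [quadPoly, MvPolynomial.C_neg]; ring

theorem quadPoly_add (α β γ κ α' β' γ' κ' : ℂ) : quadPoly α β γ κ + quadPoly α' β' γ' κ' =
    quadPoly (α + α') (β + β') (γ + γ') (κ + κ') := by
  simp only [quadPoly, MvPolynomial.C_add]; ring

theorem rootExponent_eq (hħ : ħ ≠ 0) (ρ : ℝ) (c' : ℂ) (i : Fin 3) :
    rootExponent ħ (Kre ρ c') i = hamiltonian ħ ρ c' ((Real.pi / 2) • quatUnit i.succ) := by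
  obtain ⟨h0, h1, h2⟩ := symProd_Kre ħ ρ c'
  have hħ' : (ħ : ℂ) ≠ 0 := by exact_mod_cast hħ
  have hI := Complex.I_ne_zero
  have hI2 := Complex.I_sq
  fin_cases i
  · simp [rootExponent, h1, hamiltonian, quatUnit_components, smul_quadPoly]
    congr 1 <;> field_simp
    linear_combination c' * hI2
  · simp [rootExponent, h0, h2, quadPoly_add, hamiltonian, quatUnit_components, smul_quadPoly]
    congr 1 <;> field_simp <;> ring
  · simp [rootExponent, h0, h2, hamiltonian, quatUnit_components, smul_quadPoly, sub_eq_add_neg,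
      neg_quadPoly, quadPoly_add]
    congr 1 <;> field_simp <;> norm_num

/-- A half turn about `i`: the path from `1` passes through `i` and ends at `-1`. -/
theorem polarExponent_eq (hħ : ħ ≠ 0) (ρ : ℝ) (c' : ℂ) :
    polarExponent ħ (Kre ρ c') = hamiltonian ħ ρ c' (Real.pi • quatUnit 1) := by
  have hħ' : (ħ : ℂ) ≠ 0 := by exact_mod_cast hħ
  have hI := Complex.I_ne_zero
  have hI2 := Complex.I_sq
  simp [polarExponent, (symProd_Kre ħ ρ c').2.1, hamiltonian, quatUnit_components, smul_quadPoly]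
  congr 1 <;> field_simp
  linear_combination c' * hI2

theorem starGauss_one (ħ : ℝ) (ρ c' : ℂ) : starGauss ħ ρ c' (quatUnit 0) = fun _ => 1 := by
  have h : discr ρ c' (quatUnit 0) = 1 := by simp [discr, quatUnit_zero]; ring
  funext u
  simp [starGauss, gauss, h, phaseA, phaseB, phaseC, quatUnit_zero] at h ⊢

end QuaternionGroup

/-! ### The abstract algebra: the group ring of the quaternion group, split in two. -/

section StarAlgebra

/-- The sum of the complexified quaternions and the complex group ring of the Klein four-group,
isomorphic to the group ring of the quaternion group. -/
abbrev StarAlg : Type := (ℂ ⊗[ℝ] ℍ[ℝ]) × MonoidAlgebra ℂ KleinFour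

/-- The basis `1, i, j, k` of the quaternions. -/
noncomputable def quatBasis : Module.Basis (Fin 4) ℝ ℍ[ℝ] := QuaternionAlgebra.basisOneIJK _ _ _

theorem quatBasis_apply (k : Fin 4) : quatBasis k = quatUnit k := by
  refine quatBasis.repr.injective ?_
  rw [Module.Basis.repr_self]
  ext m
  refine Eq.trans ?_ (congrFun (QuaternionAlgebra.coe_basisOneIJK_repr _ _ _ (quatUnit k)) m).symm
  fin_cases k <;> fin_cases m <;> simp <;> rfl

/-- The basis `1, i, j, k` of the complexified quaternions. -/
noncomputable def complexQuatBasis : Module.Basis (Fin 4) ℂ (ℂ ⊗[ℝ] ℍ[ℝ]) :=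
  Algebra.TensorProduct.basis ℂ quatBasis

theorem complexQuatBasis_apply (k : Fin 4) : complexQuatBasis k = 1 ⊗ₜ quatUnit k := by
  rw [complexQuatBasis, Algebra.TensorProduct.basis_apply, quatBasis_apply]

/-- The basis of the group ring of the Klein four-group. -/
noncomputable def kleinBasis : Module.Basis (Fin 4) ℂ (MonoidAlgebra ℂ KleinFour) :=
  (MonoidAlgebra.basis KleinFour ℂ).reindex kleinEquiv.symm

theorem kleinBasis_apply (k : Fin 4) : kleinBasis k = MonoidAlgebra.single (kleinEquiv k) 1 := by
  simp [kleinBasis]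

/-- The element `s w` of the quaternion group, for a sign `s` and the `k`-th quaternion `w`. -/
noncomputable def groupElem (s : ℝ) (k : Fin 4) : StarAlg :=
  (1 ⊗ₜ (s • quatUnit k), MonoidAlgebra.single (kleinEquiv k) 1)

theorem groupElem_mul (s t : ℝ) (n k : Fin 4) : groupElem s n * groupElem t k =
    groupElem (s * t * unitSign n k) (unitIdx n k) := by
  simp only [groupElem, Prod.mk_mul_mk, Algebra.TensorProduct.tmul_mul_tmul, mul_one,
    MonoidAlgebra.single_mul_single, kleinEquiv_mul]
  rw [smul_mul_smul_comm, quatUnit_mul, smul_smul]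

theorem groupElem_one : groupElem 1 0 = 1 := by
  simp only [groupElem, one_smul, quatUnit_zero]
  rfl

theorem groupElem_fst (s : ℝ) (k : Fin 4) : (groupElem s k).1 = (s : ℂ) • complexQuatBasis k := by
  rw [complexQuatBasis_apply, groupElem, TensorProduct.tmul_smul]
  exact (Complex.coe_smul s _).symm

theorem groupElem_snd (s : ℝ) (k : Fin 4) : (groupElem s k).2 = kleinBasis k :=
  (kleinBasis_apply k).symm

/-- The elements with signs `1` and `-1` have opposite quaternion components and the same Klein
component, so half sums and half differences of coordinates give the coefficients. -/
theorem eq_sum_groupElem (a : StarAlg) : a =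
    ∑ k, (((complexQuatBasis.repr a.1 k + kleinBasis.repr a.2 k) / 2) • groupElem 1 k +
      ((kleinBasis.repr a.2 k - complexQuatBasis.repr a.1 k) / 2) • groupElem (-1) k) := by
  refine Prod.ext ?_ ?_
  · conv_lhs => rw [← complexQuatBasis.sum_repr a.1]
    rw [Prod.fst_sum]
    refine Finset.sum_congr rfl fun k _ => ?_
    rw [Prod.fst_add, Prod.smul_fst, Prod.smul_fst, groupElem_fst, groupElem_fst, smul_smul,
      smul_smul, ← add_smul]
    congr 1
    push_cast
    ring
  · conv_lhs => rw [← kleinBasis.sum_repr a.2]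
    rw [Prod.snd_sum]
    refine Finset.sum_congr rfl fun k _ => ?_
    rw [Prod.snd_add, Prod.smul_snd, Prod.smul_snd, groupElem_snd, groupElem_snd, ← add_smul]
    congr 1
    ring

theorem starAlg_induction {P : StarAlg → Prop} (hadd : ∀ a b, P a → P b → P (a + b))
    (hsmul : ∀ (z : ℂ) a, P a → P (z • a))
    (h : ∀ s k, s = 1 ∨ s = -1 → P (groupElem s k)) (a : StarAlg) : P a := by
  have h0 : P 0 := by simpa using hsmul 0 _ (h 1 0 (.inl rfl))
  rw [eq_sum_groupElem a]
  exact Finset.sum_induction _ _ hadd h0 fun k _ =>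
    hadd _ _ (hsmul _ _ (h _ _ (.inl rfl))) (hsmul _ _ (h _ _ (.inr rfl)))

/-- The functions represented by the elements of `StarAlg`, if `F a` is the function of the
quaternion `a`. -/
noncomputable def symbolMap (F : ℍ[ℝ] → Symb) : StarAlg →ₗ[ℂ] Symb :=
  (complexQuatBasis.constr ℂ fun k =>
    (1 / 2 : ℂ) • (F ((1 : ℝ) • quatUnit k) - F ((-1 : ℝ) • quatUnit k))).coprod
  (kleinBasis.constr ℂ fun k =>
    (1 / 2 : ℂ) • (F ((1 : ℝ) • quatUnit k) + F ((-1 : ℝ) • quatUnit k)))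

theorem symbolMap_groupElem (F : ℍ[ℝ] → Symb) {s : ℝ} (hs : s = 1 ∨ s = -1) (k : Fin 4) :
    symbolMap F (groupElem s k) = F (s • quatUnit k) := by
  rw [symbolMap, LinearMap.coprod_apply, groupElem_fst, groupElem_snd, map_smul,
    Module.Basis.constr_basis, Module.Basis.constr_basis]
  rcases hs with rfl | rfl
  · push_cast; module
  · push_cast; module

theorem symbolMap_injective {F : ℍ[ℝ] → Symb}
    (hF : LinearIndependent ℂ fun x : Fin 4 ⊕ Fin 4 =>
      F (x.elim (fun k => (1 : ℝ) • quatUnit k) (fun k => (-1 : ℝ) • quatUnit k))) :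
    Function.Injective (symbolMap F) := by
  rw [injective_iff_map_eq_zero]
  intro a ha
  rw [eq_sum_groupElem a, map_sum] at ha
  simp only [map_add, map_smul, symbolMap_groupElem F (.inl rfl),
    symbolMap_groupElem F (.inr rfl), Finset.sum_add_distrib] at ha
  rw [Fintype.linearIndependent_iff] at hF
  have h := hF (Sum.elim (fun k => (complexQuatBasis.repr a.1 k + kleinBasis.repr a.2 k) / 2)
    (fun k => (kleinBasis.repr a.2 k - complexQuatBasis.repr a.1 k) / 2))
    (by rw [Fintype.sum_sum_type]; exact ha)
  rw [eq_sum_groupElem a]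
  refine Finset.sum_eq_zero fun k _ => ?_
  have h1 := h (.inl k)
  have h2 := h (.inr k)
  simp only [Sum.elim_inl, Sum.elim_inr] at h1 h2
  rw [h1, h2, zero_smul, zero_smul, add_zero]

/-- The polar element. -/
noncomputable def polarElem : StarAlg := groupElem (-1) 0

/-- The square roots of the polar element. -/
noncomputable def rootElem (i : Fin 3) : StarAlg := groupElem 1 i.succ

theorem polarElem_eq : polarElem = (-1, 1) := by
  rw [polarElem, groupElem, quatUnit_zero, neg_one_smul, TensorProduct.tmul_neg]
  rfl

theorem adjoin_eq_top :
    Algebra.adjoin ℂ (insert polarElem (Set.range rootElem)) = ⊤ := by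
  refine eq_top_iff.2 fun a _ => ?_
  refine starAlg_induction
    (P := (· ∈ Algebra.adjoin ℂ (insert polarElem (Set.range rootElem)))) (fun _ _ => add_mem) (fun z _ h => Subalgebra.smul_mem
    (Algebra.adjoin ℂ (insert polarElem (Set.range rootElem))) h z) ?_ a
  have h1 : ∀ k, groupElem 1 k ∈ Algebra.adjoin ℂ (insert polarElem (Set.range rootElem)) := by
    intro k
    refine Fin.cases ?_ (fun i => ?_) k
    · rw [groupElem_one]; exact one_mem _
    · exact Algebra.subset_adjoin (.inr ⟨i, rfl⟩)
  rintro s k (rfl | rfl)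
  · exact h1 k
  · have := mul_mem (Algebra.subset_adjoin (R := ℂ)
      (Set.mem_insert polarElem (Set.range rootElem))) (h1 k)
    have e : polarElem * groupElem 1 k = groupElem (-1) k := by
      rw [polarElem, groupElem_mul, (unit_zero_left k).1, (unit_zero_left k).2, mul_one, mul_one]
    rwa [e] at this

theorem polar_mul_polar : polarElem * polarElem = 1 := by
  rw [polarElem, groupElem_mul]
  simp [unitSign, unitIdx, groupElem_one]

theorem root_mul_root (i : Fin 3) : rootElem i * rootElem i = polarElem := by
  rw [rootElem, groupElem_mul, polarElem]
  fin_cases i <;> simp [unitSign, unitIdx]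

theorem root_mul_root_succ : rootElem 0 * rootElem 1 = rootElem 2 ∧
    rootElem 1 * rootElem 2 = rootElem 0 ∧ rootElem 2 * rootElem 0 = rootElem 1 := by
  refine ⟨?_, ?_, ?_⟩ <;> rw [rootElem, rootElem, groupElem_mul, rootElem] <;>
    simp [unitSign, unitIdx]

theorem root_mul_root_of_ne {i j : Fin 3} (h : i ≠ j) :
    rootElem i * rootElem j = polarElem * (rootElem j * rootElem i) := by
  rw [rootElem, rootElem, groupElem_mul, polarElem, groupElem_mul, groupElem_mul]
  fin_cases i <;> fin_cases j <;> first | exact absurd rfl h | simp [unitSign, unitIdx]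

theorem half_one_add_polar : ((0, 1) : StarAlg) = (1 / 2 : ℂ) • (1 + polarElem) := by
  rw [polarElem_eq]
  refine Prod.ext ?_ ?_
  · simp
  · change (1 : MonoidAlgebra ℂ KleinFour) = (1 / 2 : ℂ) • (1 + 1)
    module

theorem half_one_sub_polar : ((1, 0) : StarAlg) = (1 / 2 : ℂ) • (1 - polarElem) := by
  rw [polarElem_eq]
  refine Prod.ext ?_ ?_
  · change (1 : ℂ ⊗[ℝ] ℍ[ℝ]) = (1 / 2 : ℂ) • (1 - -1)
    module
  · simp

/-- The first factor of `StarAlg`. -/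
noncomputable def fstEquiv : (ℂ ⊗[ℝ] ℍ[ℝ]) ≃+* piece ((1, 0) : StarAlg) where
  toFun x := ⟨(x, 0), (x, 0), Prod.ext (one_mul x).symm (mul_zero _).symm⟩
  invFun y := y.1.1
  left_inv _ := rfl
  right_inv := by
    rintro ⟨_, a, rfl⟩
    exact Subtype.ext (Prod.ext rfl (zero_mul a.2).symm)
  map_mul' x y := Subtype.ext (Prod.ext rfl (mul_zero _).symm)
  map_add' x y := Subtype.ext (Prod.ext rfl (add_zero _).symm)

/-- The second factor of `StarAlg`. -/
noncomputable def sndEquiv : MonoidAlgebra ℂ KleinFour ≃+* piece ((0, 1) : StarAlg) where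
  toFun x := ⟨(0, x), (0, x), Prod.ext (mul_zero (0 : ℂ ⊗[ℝ] ℍ[ℝ])).symm (one_mul x).symm⟩
  invFun y := y.1.2
  left_inv _ := rfl
  right_inv := by
    rintro ⟨_, a, rfl⟩
    exact Subtype.ext (Prod.ext (zero_mul a.1).symm rfl)
  map_mul' x y := Subtype.ext (Prod.ext (mul_zero (0 : ℂ ⊗[ℝ] ℍ[ℝ])).symm rfl)
  map_add' x y := Subtype.ext (Prod.ext (add_zero _).symm rfl)

/-- An isomorphism would make the complexified quaternions commutative, but `i j = k` and `j i =
-k`. -/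
theorem isEmpty_pieceEquiv :
    IsEmpty (piece ((1, 0) : StarAlg) ≃+* piece ((0, 1) : StarAlg)) := by
  refine ⟨fun e => ?_⟩
  let f := (fstEquiv.trans e).trans sndEquiv.symm
  have hcomm : ∀ x y : ℂ ⊗[ℝ] ℍ[ℝ], x * y = y * x := fun x y =>
    f.injective (by rw [map_mul, map_mul, mul_comm])
  have h := hcomm (1 ⊗ₜ quatUnit 1) (1 ⊗ₜ quatUnit 2)
  simp only [Algebra.TensorProduct.tmul_mul_tmul, quatUnit_mul, mul_one, TensorProduct.tmul_smul] at h
  have h2 : complexQuatBasis 3 = -complexQuatBasis 3 := by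
    rw [complexQuatBasis_apply]
    simpa [unitSign, unitIdx] using h
  have h3 := congrArg (fun x => complexQuatBasis.repr x 3) h2
  simp at h3
  norm_num [self_eq_neg] at h3

end StarAlgebra

/-! ### Realizing the abstract algebra by functions, and the theorem. -/

section Main

/-- The function represented by an element of `StarAlg`. -/
noncomputable def starSymbol (ħ ρ c θ : ℝ) : StarAlg →ₗ[ℂ] Symb :=
  symbolMap (starGauss ħ ρ (c + Complex.I * θ))

variable {ħ ρ c θ : ℝ}

theorem starSymbol_injective (hħ : ħ ≠ 0) (hθ : |θ| < |ρ|) (hc : c ≠ 0) :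
    Function.Injective (starSymbol ħ ρ c θ) := by
  let a : Fin 4 ⊕ Fin 4 → ℍ[ℝ] := fun x =>
    x.elim (fun k => (1 : ℝ) • quatUnit k) (fun k => (-1 : ℝ) • quatUnit k)
  have hmem : ∀ x, ∃ k m : Fin 4, k ≠ m ∧ ¬ (k = 1 ∧ m = 2 ∨ k = 2 ∧ m = 1) ∧
      ∃ s : ℝ, s ^ 2 + 0 ^ 2 = 1 ∧ a x = s • quatUnit k + (0 : ℝ) • quatUnit m := by
    -- Each of the eight points also lies on a non-exceptional circle, so its discriminant is
    -- nonzero without the extra condition.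
    have h : ∀ k : Fin 4, ∃ m, k ≠ m ∧ ¬ (k = 1 ∧ m = 2 ∨ k = 2 ∧ m = 1) := by decide
    rintro (k | k) <;> obtain ⟨m, h1, h2⟩ := h k
    · exact ⟨k, m, h1, h2, 1, by norm_num, by simp [a]⟩
    · exact ⟨k, m, h1, h2, -1, by norm_num, by simp [a]⟩
  refine symbolMap_injective (linearIndependent_starGauss (a := a) hħ
    (one_add_det_ne_zero hθ) ?_ ?_ ?_)
  · intro x y hxy
    have h0 := congrArg (·.re) hxy
    have h1 := congrArg (·.imI) hxy
    have h2 := congrArg (·.imJ) hxy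
    have h3 := congrArg (·.imK) hxy
    rcases x with k | k <;> rcases y with m | m <;> fin_cases k <;> fin_cases m <;>
      first | rfl | (exfalso; simp [a, quatUnit_components] at h0 h1 h2 h3; try norm_num at *)
  · intro x
    obtain ⟨k, m, h1, -, s, hs, e⟩ := hmem x
    have := (quatUnit_path_normSq h1 s 0).trans hs
    rw [← e] at this
    exact this
  · intro x
    obtain ⟨k, m, h1, h2, s, hs, e⟩ := hmem x
    rw [e]
    exact Complex.slitPlane_ne_zero
      (discr_quatUnit_mem_slitPlane hθ hc h1 (fun h => absurd h h2) hs)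

theorem differentiable_starSymbol (a : StarAlg) : Differentiable ℂ (starSymbol ħ ρ c θ a) := by
  refine starAlg_induction (P := fun a => Differentiable ℂ (starSymbol ħ ρ c θ a))
    (fun a b ha hb => ?_) (fun z a ha => ?_) (fun s k hs => ?_) a
  · rw [map_add]; exact ha.add hb
  · rw [map_smul]; exact ha.const_smul z
  · rw [starSymbol, symbolMap_groupElem _ hs]; exact differentiable_gauss _ _ _ _

theorem starSymbol_one : starSymbol ħ ρ c θ 1 = fun _ => 1 := by
  rw [← groupElem_one, starSymbol, symbolMap_groupElem _ (.inl rfl), one_smul, starGauss_one]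

/-- Both sides are linear in the element, so the eight group elements suffice; applied to left and
right multiplications. -/
theorem evolvesTo_of_groupElem {Λ : Matrix (Fin 2) (Fin 2) ℂ} {H : PolySymb}
    (L : StarAlg →ₗ[ℂ] StarAlg)
    (h : ∀ s k, s = 1 ∨ s = -1 → EvolvesTo ħ Λ H (starSymbol ħ ρ c θ (groupElem s k))
      (starSymbol ħ ρ c θ (L (groupElem s k)))) (a : StarAlg) :
    EvolvesTo ħ Λ H (starSymbol ħ ρ c θ a) (starSymbol ħ ρ c θ (L a)) := by
  refine starAlg_induction (P := fun a => EvolvesTo ħ Λ H (starSymbol ħ ρ c θ a)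
    (starSymbol ħ ρ c θ (L a))) (fun a b ha hb => ?_) (fun z a ha => ?_) h a
  · simp only [map_add]; exact ha.add hb
  · simp only [map_smul]; exact ha.smul z

theorem mul_eq_one_or_neg_one {s t : ℝ} (hs : s = 1 ∨ s = -1) (ht : t = 1 ∨ t = -1) :
    s * t = 1 ∨ s * t = -1 := by
  rcases hs with rfl | rfl <;> rcases ht with rfl | rfl <;> simp

theorem isStarExpMul_root (hħ : ħ ≠ 0) (hθ : |θ| < |ρ|) (hc : c ≠ 0) {i : Fin 3} {s : ℝ}
    {k : Fin 4} (hs : s = 1 ∨ s = -1) (h : i.succ = 3 ∧ (k = 1 ∨ k = 2) →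
      ¬ ((|ρ| - |θ|) ^ 2 + c ^ 2 ≤ 1 ∧ 1 ≤ (|ρ| + |θ|) ^ 2 + c ^ 2)) :
    IsStarExpMul ħ (Kre ρ (c + Complex.I * θ)) (rootExponent ħ (Kre ρ (c + Complex.I * θ)) i)
      (starSymbol ħ ρ c θ (groupElem s k)) (starSymbol ħ ρ c θ (rootElem i * groupElem s k)) := by
  rw [IsStarExpMul, Kre_add_skewJ, rootExponent_eq hħ, rootElem, groupElem_mul, starSymbol,
    symbolMap_groupElem _ hs, one_mul, symbolMap_groupElem _ (mul_eq_one_or_neg_one hs (unitSign_eq _ _))]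
  have := evolvesTo_left hħ hθ hc hs (Fin.succ_ne_zero i) h (Real.pi / 2)
  simpa only [Real.cos_pi_div_two, Real.sin_pi_div_two, zero_smul, zero_add, one_smul] using this

theorem isMulStarExp_root (hħ : ħ ≠ 0) (hθ : |θ| < |ρ|) (hc : c ≠ 0) {i : Fin 3} {s : ℝ}
    {k : Fin 4} (hs : s = 1 ∨ s = -1) (h : i.succ = 3 ∧ (k = 1 ∨ k = 2) →
      ¬ ((|ρ| - |θ|) ^ 2 + c ^ 2 ≤ 1 ∧ 1 ≤ (|ρ| + |θ|) ^ 2 + c ^ 2)) :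
    IsMulStarExp ħ (Kre ρ (c + Complex.I * θ)) (rootExponent ħ (Kre ρ (c + Complex.I * θ)) i)
      (starSymbol ħ ρ c θ (groupElem s k)) (starSymbol ħ ρ c θ (groupElem s k * rootElem i)) := by
  rw [IsMulStarExp, Kre_add_skewJ_transpose, rootExponent_eq hħ, rootElem, groupElem_mul,
    starSymbol, symbolMap_groupElem _ hs, mul_one,
    symbolMap_groupElem _ (mul_eq_one_or_neg_one hs (unitSign_eq _ _))]
  have := evolvesTo_right hħ hθ hc hs (Fin.succ_ne_zero i) h (Real.pi / 2)
  simpa only [Real.cos_pi_div_two, Real.sin_pi_div_two, zero_smul, zero_add, one_smul] using this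

theorem isStarExpMul_polar (hħ : ħ ≠ 0) (hθ : |θ| < |ρ|) (hc : c ≠ 0) (a : StarAlg) :
    IsStarExpMul ħ (Kre ρ (c + Complex.I * θ)) (polarExponent ħ (Kre ρ (c + Complex.I * θ)))
      (starSymbol ħ ρ c θ a) (starSymbol ħ ρ c θ (polarElem * a)) := by
  refine evolvesTo_of_groupElem (LinearMap.mulLeft ℂ polarElem) (fun s k hs => ?_) a
  have := evolvesTo_left (k := k) hħ hθ hc hs one_ne_zero (fun h => absurd h.1 (by decide)) Real.pi
  rw [Kre_add_skewJ, polarExponent_eq hħ, LinearMap.mulLeft_apply, polarElem, groupElem_mul]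
  rw [(unit_zero_left k).1, (unit_zero_left k).2, mul_one, neg_one_mul, starSymbol, symbolMap_groupElem _ hs, symbolMap_groupElem]
  · simpa only [Real.cos_pi, Real.sin_pi, zero_smul, add_zero, neg_smul, one_smul] using this
  · rcases hs with rfl | rfl <;> simp

theorem isMulStarExp_polar (hħ : ħ ≠ 0) (hθ : |θ| < |ρ|) (hc : c ≠ 0) (a : StarAlg) :
    IsMulStarExp ħ (Kre ρ (c + Complex.I * θ)) (polarExponent ħ (Kre ρ (c + Complex.I * θ)))
      (starSymbol ħ ρ c θ a) (starSymbol ħ ρ c θ (a * polarElem)) := by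
  refine evolvesTo_of_groupElem (LinearMap.mulRight ℂ polarElem) (fun s k hs => ?_) a
  have := evolvesTo_right (k := k) hħ hθ hc hs one_ne_zero (fun h => absurd h.1 (by decide)) Real.pi
  rw [Kre_add_skewJ_transpose, polarExponent_eq hħ, LinearMap.mulRight_apply, polarElem,
    groupElem_mul]
  rw [(unit_zero_right k).1, (unit_zero_right k).2, mul_one, mul_neg_one, starSymbol, symbolMap_groupElem _ hs, symbolMap_groupElem]
  · simpa only [Real.cos_pi, Real.sin_pi, zero_smul, add_zero, neg_smul, one_smul] using this
  · rcases hs with rfl | rfl <;> simp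

end Main

theorem mainTheorem5 (ħ : ℝ) (hħ : 0 < ħ) (ρ c θ : ℝ) (c' : ℂ) (hc' : c' = c + Complex.I * θ)
    (hK : ‖(1 + ρ + Complex.I * c') / (1 - ρ - Complex.I * c')‖ ≠ 1)
    (hθ : |θ| < |ρ|) (hc : c ≠ 0) :
    ∃ (𝒜 : Type) (_ : Ring 𝒜) (_ : Algebra ℂ 𝒜) (ι : 𝒜 →ₗ[ℂ] Symb) (ε : 𝒜) (e : Fin 3 → 𝒜),
      -- the elements of `𝒜` are functions, `1` being the constant function
      Function.Injective ι ∧ (∀ a, Differentiable ℂ (ι a)) ∧ ι 1 = (fun _ => 1) ∧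
      -- `ε`, `e₁`, `e₂`, `e₃` are the polar element and the three star-exponentials
      IsStarExp ħ (Kre ρ c') (polarExponent ħ (Kre ρ c')) (ι ε) ∧
      (∀ i, IsStarExp ħ (Kre ρ c') (rootExponent ħ (Kre ρ c') i) (ι (e i))) ∧
      -- the product of `𝒜` is the star product
      (∀ a, IsStarExpMul ħ (Kre ρ c') (polarExponent ħ (Kre ρ c')) (ι a) (ι (ε * a)) ∧
        IsMulStarExp ħ (Kre ρ c') (polarExponent ħ (Kre ρ c')) (ι a) (ι (a * ε))) ∧
      (∀ i : Fin 3, (i = 2 → ¬ ((|ρ| - |θ|) ^ 2 + c ^ 2 ≤ 1 ∧ 1 ≤ (|ρ| + |θ|) ^ 2 + c ^ 2)) →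
        ∀ a, IsStarExpMul ħ (Kre ρ c') (rootExponent ħ (Kre ρ c') i) (ι a) (ι (e i * a)) ∧
          IsMulStarExp ħ (Kre ρ c') (rootExponent ħ (Kre ρ c') i) (ι a) (ι (a * e i))) ∧
      IsStarExpMul ħ (Kre ρ c') (rootExponent ħ (Kre ρ c') 2) (ι (e 2)) (ι (e 2 * e 2)) ∧
      -- `𝒜` is generated by these elements
      Algebra.adjoin ℂ (insert ε (Set.range e)) = ⊤ ∧
      -- `e₁`, `e₂`, `e₃` are square roots of `ε`
      ε * ε = 1 ∧ (∀ i, e i * e i = ε) ∧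
      e 0 * e 1 = e 2 ∧ e 1 * e 2 = e 0 ∧ e 2 * e 0 = e 1 ∧
      (∀ i j, i ≠ j → e i * e j = ε * (e j * e i)) ∧
      ∃ p q : 𝒜, p = (1 / 2 : ℂ) • (1 + ε) ∧ q = (1 / 2 : ℂ) • (1 - ε) ∧
        -- complementary idempotents
        IsIdempotentElem p ∧ IsIdempotentElem q ∧ 1 = p + q ∧ p * q = 0 ∧ q * p = 0 ∧
        -- relations in `q * 𝒜`
        q * ε = -q ∧ (∀ i, (q * e i) * (q * e i) = -q) ∧
        (∀ i j, i ≠ j → (q * e i) * (q * e j) = -q * ((q * e j) * (q * e i))) ∧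
        -- `q * 𝒜` is the complexified quaternion algebra
        (∃ φ : (ℂ ⊗[ℝ] ℍ[ℝ]) ≃+* piece q, (∀ (z : ℂ) x, φ (z • x) = z • φ x) ∧
          (φ 1 : 𝒜) = q ∧
          (φ (1 ⊗ₜ[ℝ] (⟨0, 1, 0, 0⟩ : ℍ[ℝ])) : 𝒜) = q * e 0 ∧
          (φ (1 ⊗ₜ[ℝ] (⟨0, 0, 1, 0⟩ : ℍ[ℝ])) : 𝒜) = q * e 1 ∧
          (φ (1 ⊗ₜ[ℝ] (⟨0, 0, 0, 1⟩ : ℍ[ℝ])) : 𝒜) = q * e 2) ∧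
        -- `p * 𝒜` is the complex group ring of the Klein four-group
        (∃ ψ : MonoidAlgebra ℂ (Multiplicative (ZMod 2 × ZMod 2)) ≃+* piece p,
          (∀ (z : ℂ) x, ψ (z • x) = z • ψ x) ∧
          (ψ 1 : 𝒜) = p ∧
          (ψ (MonoidAlgebra.single (Multiplicative.ofAdd (1, 0)) 1) : 𝒜) = p * e 0 ∧
          (ψ (MonoidAlgebra.single (Multiplicative.ofAdd (0, 1)) 1) : 𝒜) = p * e 1 ∧
          (ψ (MonoidAlgebra.single (Multiplicative.ofAdd (1, 1)) 1) : 𝒜) = p * e 2) ∧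
        -- the two pieces are not isomorphic
        IsEmpty (piece q ≃+* piece p) := by
  subst hc'
  have hħ' : ħ ≠ 0 := hħ.ne'
  have hq : ((1, 0) : StarAlg) * polarElem = -(1, 0) := by
    rw [polarElem_eq]
    exact Prod.ext (one_mul (-1 : ℂ ⊗[ℝ] ℍ[ℝ]))
      ((zero_mul (1 : MonoidAlgebra ℂ KleinFour)).trans neg_zero.symm)
  have hqa : ∀ a : StarAlg, (1, 0) * a = (a.1, 0) := fun a =>
    Prod.ext (one_mul a.1) (zero_mul a.2)
  have hpa : ∀ a : StarAlg, (0, 1) * a = (0, a.2) := fun a =>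
    Prod.ext (zero_mul a.1) (one_mul a.2)
  have hqq : ((1, 0) : StarAlg) * (1, 0) = (1, 0) := Prod.ext (one_mul (1 : ℂ ⊗[ℝ] ℍ[ℝ]))
    (zero_mul (0 : MonoidAlgebra ℂ KleinFour))
  have hqmul : ∀ a b : StarAlg, (1, 0) * a * ((1, 0) * b) = (1, 0) * (a * b) := fun a b => by
    rw [hqa, hqa, hqa]
    exact Prod.ext rfl (mul_zero (0 : MonoidAlgebra ℂ KleinFour))
  refine ⟨StarAlg, inferInstance, inferInstance, starSymbol ħ ρ c θ, polarElem, rootElem,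
    starSymbol_injective hħ' hθ hc, differentiable_starSymbol, starSymbol_one, ?_, fun i => ?_,
    fun a => ⟨isStarExpMul_polar hħ' hθ hc a, isMulStarExp_polar hħ' hθ hc a⟩,
    fun i hi a => ?_, ?_, adjoin_eq_top, polar_mul_polar, root_mul_root, root_mul_root_succ.1,
    root_mul_root_succ.2.1, root_mul_root_succ.2.2, fun i j => root_mul_root_of_ne,
    (0, 1), (1, 0), half_one_add_polar, half_one_sub_polar,
    Prod.ext (zero_mul (0 : ℂ ⊗[ℝ] ℍ[ℝ])) (one_mul (1 : MonoidAlgebra ℂ KleinFour)), hqq,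
    Prod.ext (zero_add (1 : ℂ ⊗[ℝ] ℍ[ℝ])).symm (add_zero (1 : MonoidAlgebra ℂ KleinFour)).symm,
    Prod.ext (zero_mul (1 : ℂ ⊗[ℝ] ℍ[ℝ])) (mul_zero (1 : MonoidAlgebra ℂ KleinFour)),
    Prod.ext (mul_zero (1 : ℂ ⊗[ℝ] ℍ[ℝ])) (zero_mul (1 : MonoidAlgebra ℂ KleinFour)), hq, fun i => ?_,
    fun i j hij => ?_, ⟨fstEquiv, fun z x => ?_, rfl, ?_, ?_, ?_⟩,
    ⟨sndEquiv, fun z x => ?_, rfl, ?_, ?_, ?_⟩, isEmpty_pieceEquiv⟩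
  · have := isStarExpMul_polar hħ' hθ hc (1 : StarAlg)
    have e : polarElem * 1 = polarElem :=
      Prod.ext (mul_one polarElem.1) (mul_one polarElem.2)
    rwa [e, starSymbol_one] at this
  -- A path from `1` never follows the exceptional circle, so `e₃` itself is defined without
  -- restriction.
  · have := isStarExpMul_root (i := i) (k := 0) hħ' hθ hc (.inl rfl)
      (fun h => absurd h.2 (by decide))
    have e : rootElem i * 1 = rootElem i :=
      Prod.ext (mul_one (rootElem i).1) (mul_one (rootElem i).2)
    rwa [groupElem_one, e, starSymbol_one] at this
  · have hi' : ∀ k : Fin 4, i.succ = 3 ∧ (k = 1 ∨ k = 2) →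
        ¬ ((|ρ| - |θ|) ^ 2 + c ^ 2 ≤ 1 ∧ 1 ≤ (|ρ| + |θ|) ^ 2 + c ^ 2) := fun k h =>
      hi (Fin.succ_injective _ h.1)
    exact ⟨evolvesTo_of_groupElem (LinearMap.mulLeft ℂ (rootElem i))
        (fun s k hs => isStarExpMul_root hħ' hθ hc hs (hi' k)) a,
      evolvesTo_of_groupElem (LinearMap.mulRight ℂ (rootElem i))
        (fun s k hs => isMulStarExp_root hħ' hθ hc hs (hi' k)) a⟩
  -- The path from `k` under multiplication by `k` lies in the span of `1` and `k`, again not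
  -- exceptional.
  · exact isStarExpMul_root hħ' hθ hc (.inl rfl) (fun h => absurd h.2 (by decide))
  · rw [hqmul, root_mul_root, hq]
  · have e1 : ∀ a : StarAlg, (1, 0) * (polarElem * a) = (1, 0) * polarElem * a := fun a =>
      (mul_assoc ((1, 0) : StarAlg) polarElem a).symm
    have e2 : ∀ a : StarAlg, -(1, 0) * ((1, 0) * a) = -(1, 0) * a := fun a => by
      rw [hqa]
      refine Prod.ext rfl ?_
      change (-0 : MonoidAlgebra ℂ KleinFour) * 0 = -0 * a.2
      rw [neg_zero, zero_mul, zero_mul]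
    rw [hqmul, hqmul, root_mul_root_of_ne hij, e1, hq, e2]
  · exact Subtype.ext (Prod.ext rfl (smul_zero z).symm)
  · rw [hqa, rootElem, groupElem, one_smul]; rfl
  · rw [hqa, rootElem, groupElem, one_smul]; rfl
  · rw [hqa, rootElem, groupElem, one_smul]; rfl
  · exact Subtype.ext (Prod.ext (smul_zero z).symm rfl)
  · rw [hpa]; rfl
  · rw [hpa]; rfl
  · rw [hpa]; rfl
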